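/- Let $M$ be a smooth ($C^\infty$, Hausdorff, finite-dimensional) manifold and let $L(M)$ be its loop space, the space of smooth maps $u:S^1\to M$. A flat Fedosov structure $(\omega,\nabla)$ on $M$ is a symplectic form $\omega$ together with a smooth torsion-free connection $\nabla$ on $TM$ with $\nabla\omega=0$ and zero curvature. In local coordinates $u^i$ write $\omega=\tfrac12\omega_{ij}\,du^i\wedge du^j$, let $\omega^{ij}$ be the inverse matrix ($\omega_{ir}\omega^{rj}=\delta_i^j$), let $\Gamma^k_{ij}$ be the Christoffel symbols of $\nabla$ and put $$\Gamma^{ij}_k=-\omega^{ir}\Gamma^j_{rk},\qquad c^{ij}_{kl}=\Gamma^{ij}_{(k,l)}-\omega_{pr}\Gamma^{ri}_{(k}\Gamma^{pj}_{l)},$$ where round brackets denote symmetrisation in $k,l$ and a comma denotes partial differentiation. To $(\omega,\nabla)$ one associates the degree-2 operator $$P^{ij}=\omega^{ij}\Big(\frac{d}{dx}\Big)^2+2\Gamma^{ij}_k u^k_x\frac{d}{dx}+c^{ij}_{kl}u^k_xu^l_x+\Gamma^{ij}_k u^k_{xx}.$$ A matrix differential operator $P^{ij}$ on $L(M)$ is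 called Hamiltonian if $$\{F,G\}=\int_{S^1}\frac{\delta F}{\delta u^i}\,P^{ij}\Big(\frac{\delta G}{\delta u^j}\Big)\,dx$$ is skew-symmetric and satisfies the Jacobi identity on local functionals $F[u]=\int_{S^1} f(x,u,u_x,u_{xx},\dots)\,dx$ on $L(M)$. Two such operators are called compatible if every linear combination of them with constant real coefficients is Hamiltonian. Theorem. Let $P_1$ and $P_2$ be the operators associated with two flat Fedosov structures $(\omega_1,\nabla^1)$ and $(\omega_2,\nabla^2)$ on $M$. If $P_1$ and $P_2$ are compatible, then their leading coefficients $\omega_1^{ij}$ and $\omega_2^{ij}$ form a finite-dimensional bi-Hamiltonian structure on $M$: for all real $s,t$ the operation $$\{f,g\}=\big(s\,\omega_1^{ij}+t\,\omega_2^{ij}\big)\frac{\partial f}{\partial u^i}\frac{\partial g}{\partial u^j}$$ is a Poisson bracket on $C^\infty(M)$ (it is skew-symmetric and bilinear, and satisfies the product rule and the Jacobi identity). -/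

import Mathlib

open scoped Manifold ContDiff Topology Bundle

noncomputable section

namespace FedosovPencil

/-! ### Local coordinates on the target manifold -/

/-- The model space of an `n`-dimensional real manifold. -/
abbrev Model (n : ℕ) : Type := EuclideanSpace ℝ (Fin n)

section Coordinates

variable {n : ℕ} {M : Type*} [TopologicalSpace M] [ChartedSpace (Model n) M]

/-- The coordinate vector field `∂/∂uⁱ` of a chart `φ = (u¹, …, uⁿ)`
(meaningful on `φ.source`). -/
def coordVF (φ : OpenPartialHomeomorph M (Model n)) (i : Fin n) (p : M) :
    TangentSpace (𝓡 n) p :=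
  (mvfderiv (𝓡 n) φ p).inverse (EuclideanSpace.single i (1 : ℝ))

/-- The partial derivative `∂f/∂uⁱ` of a function on `M` in the chart `φ`. -/
def coordDeriv (φ : OpenPartialHomeomorph M (Model n)) (i : Fin n) (f : M → ℝ) (p : M) : ℝ :=
  mvfderiv (𝓡 n) f p (coordVF φ i p)

variable [IsManifold (𝓡 n) ∞ M]

/-- The vector field `X` is differentiable at `p`. -/
def IsDifferentiableVFAt (X : ∀ p : M, TangentSpace (𝓡 n) p) (p : M) : Prop :=
  MDifferentiableAt (𝓡 n) (𝓡 n).tangent (fun q => (⟨q, X q⟩ : TangentBundle (𝓡 n) M)) p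

/-- The vector field `X` is smooth. -/
def IsSmoothVF (X : ∀ p : M, TangentSpace (𝓡 n) p) : Prop :=
  ContMDiff (𝓡 n) (𝓡 n).tangent ∞ (fun q => (⟨q, X q⟩ : TangentBundle (𝓡 n) M))

end Coordinates

/-! ### Flat Fedosov structures -/

/-- A flat Fedosov structure on `M`: a symplectic form `ω` together with a smooth connection that is
torsion-free, compatible with `ω` and of vanishing curvature.
In Mathlib's convention `conn Y p (X p)` is `(∇_X Y)(p)`. -/
structure FlatFedosovStructure (n : ℕ) (M : Type*) [TopologicalSpace M]
    [ChartedSpace (Model n) M] [IsManifold (𝓡 n) ∞ M] where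
  /-- the two-form `ω` -/
  form : ∀ p : M, TangentSpace (𝓡 n) p →L[ℝ] TangentSpace (𝓡 n) p →L[ℝ] ℝ
  form_smooth : ∀ φ ∈ atlas (Model n) M, ∀ i j : Fin n,
    ContMDiffOn (𝓡 n) 𝓘(ℝ, ℝ) ∞ (fun p => form p (coordVF φ i p) (coordVF φ j p)) φ.source
  form_skew : ∀ (p : M) (v w : TangentSpace (𝓡 n) p), form p v w = -form p w v
  form_nondegenerate : ∀ (p : M) (v : TangentSpace (𝓡 n) p), (∀ w, form p v w = 0) → v = 0
  /-- `dω = 0` -/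
  form_closed : ∀ φ ∈ atlas (Model n) M, ∀ p ∈ φ.source, ∀ i j k : Fin n,
    coordDeriv φ i (fun q => form q (coordVF φ j q) (coordVF φ k q)) p
      + coordDeriv φ j (fun q => form q (coordVF φ k q) (coordVF φ i q)) p
      + coordDeriv φ k (fun q => form q (coordVF φ i q) (coordVF φ j q)) p = 0
  /-- the connection `∇` on the tangent bundle -/
  conn : CovariantDerivative (𝓡 n) (Model n) (TangentSpace (𝓡 n) : M → Type _)
  conn_smooth : CovariantDerivative.ContMDiffCovariantDerivative conn ∞
  /-- `∇_X Y - ∇_Y X = [X, Y]` -/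
  conn_torsionFree : ∀ (X Y : ∀ p : M, TangentSpace (𝓡 n) p) (p : M),
    IsDifferentiableVFAt X p → IsDifferentiableVFAt Y p →
      conn Y p (X p) - conn X p (Y p) = VectorField.mlieBracket (𝓡 n) X Y p
  /-- `X(ω(Y, Z)) = ω(∇_X Y, Z) + ω(Y, ∇_X Z)` -/
  conn_compatible : ∀ (X Y Z : ∀ p : M, TangentSpace (𝓡 n) p) (p : M),
    IsDifferentiableVFAt Y p → IsDifferentiableVFAt Z p →
      mvfderiv (𝓡 n) (fun q => form q (Y q) (Z q)) p (X p)
        = form p (conn Y p (X p)) (Z p) + form p (Y p) (conn Z p (X p))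
  /-- `∇_X ∇_Y Z - ∇_Y ∇_X Z - ∇_[X,Y] Z = 0` -/
  conn_flat : ∀ X Y Z : ∀ p : M, TangentSpace (𝓡 n) p,
    IsSmoothVF X → IsSmoothVF Y → IsSmoothVF Z → ∀ p : M,
      conn (fun q => conn Z q (Y q)) p (X p) - conn (fun q => conn Z q (X q)) p (Y p)
        - conn Z p (VectorField.mlieBracket (𝓡 n) X Y p) = 0

namespace FlatFedosovStructure

variable {n : ℕ} {M : Type*} [TopologicalSpace M] [ChartedSpace (Model n) M]
  [IsManifold (𝓡 n) ∞ M]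

/-- The matrix `ω_{ij}` of the symplectic form in the chart `φ`. -/
def lower (S : FlatFedosovStructure n M) (φ : OpenPartialHomeomorph M (Model n)) (p : M) :
    Matrix (Fin n) (Fin n) ℝ :=
  Matrix.of fun i j => S.form p (coordVF φ i p) (coordVF φ j p)

/-- The inverse matrix `ω^{ij}`, so that `ω_{ir} ω^{rj} = δ_i^j`. -/
def upper (S : FlatFedosovStructure n M) (φ : OpenPartialHomeomorph M (Model n)) (p : M) :
    Matrix (Fin n) (Fin n) ℝ :=
  (S.lower φ p)⁻¹

/-- The Christoffel symbols `Γ^k_{ij}`: `∇_{∂_i} ∂_j = Γ^k_{ij} ∂_k`. -/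
def christoffel (S : FlatFedosovStructure n M) (φ : OpenPartialHomeomorph M (Model n))
    (k i j : Fin n) (p : M) : ℝ :=
  mvfderiv (𝓡 n) φ p (S.conn (coordVF φ j) p (coordVF φ i p)) k

/-- The contravariant Christoffel symbols `Γ^{ij}_k = -ω^{ir} Γ^j_{rk}`. -/
def contraChristoffel (S : FlatFedosovStructure n M) (φ : OpenPartialHomeomorph M (Model n))
    (i j k : Fin n) (p : M) : ℝ :=
  -∑ r, S.upper φ p i r * S.christoffel φ j r k p

/-- `c^{ij}_{kl} = Γ^{ij}_{(k,l)} - ω_{pr} Γ^{ri}_{(k} Γ^{pj}_{l)}`, the brackets denoting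
symmetrisation (with the factor `1/2`) and the comma partial differentiation. -/
def quadCoeff (S : FlatFedosovStructure n M) (φ : OpenPartialHomeomorph M (Model n))
    (i j k l : Fin n) (q : M) : ℝ :=
  (1 / 2) * (coordDeriv φ l (S.contraChristoffel φ i j k) q
      + coordDeriv φ k (S.contraChristoffel φ i j l) q)
    - (1 / 2) * ∑ p, ∑ r, S.lower φ q p r *
        (S.contraChristoffel φ r i k q * S.contraChristoffel φ p j l q
          + S.contraChristoffel φ r i l q * S.contraChristoffel φ p j k q)

end FlatFedosovStructure

/-! ### The loop space, functionals and their variational derivatives -/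

section LoopSpace

variable (n : ℕ) (M : Type*) [TopologicalSpace M] [ChartedSpace (Model n) M]

/-- A point of the loop space `L(M)`: a smooth map `S¹ = ℝ/ℤ → M`, written as a smooth
`1`-periodic map `ℝ → M`. -/
structure Loop where
  toFun : ℝ → M
  smooth : ContMDiff 𝓘(ℝ, ℝ) (𝓡 n) ∞ toFun
  periodic : ∀ x, toFun (x + 1) = toFun x

instance : CoeFun (Loop n M) fun _ => ℝ → M := ⟨Loop.toFun⟩

variable {n M}

/-- A (not necessarily smooth) covector field along the loop `u`. -/
abbrev CovectorAlong (u : Loop n M) : Type _ := ∀ x : ℝ, TangentSpace (𝓡 n) (u x) →L[ℝ] ℝ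

/-- The component `α_i(x)` of a covector field along `u` in the chart `φ`
(meaningful where `u x ∈ φ.source`). -/
def comp {u : Loop n M} (φ : OpenPartialHomeomorph M (Model n)) (α : CovectorAlong u)
    (i : Fin n) (x : ℝ) : ℝ :=
  α x (coordVF φ i (u x))

/-- The covector field along `u` is smooth and `1`-periodic, i.e. a smooth section of the pull-back
of the cotangent bundle to `S¹`. -/
def IsSmoothCovector {u : Loop n M} (α : CovectorAlong u) : Prop :=
  ∀ φ ∈ atlas (Model n) M, ∀ i : Fin n,
    ContDiffOn ℝ ∞ (comp φ α i) (u ⁻¹' φ.source) ∧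
      ∀ x, u x ∈ φ.source → comp φ α i (x + 1) = comp φ α i x

/-- A smooth variation `u_ε`, `ε ∈ ℝ`, of the loop `u = u_0`. -/
structure Variation (u : Loop n M) where
  toFun : ℝ → Loop n M
  smooth : ContMDiff 𝓘(ℝ, ℝ × ℝ) (𝓡 n) ∞ (fun z : ℝ × ℝ => toFun z.1 z.2)
  zero : ∀ x, toFun 0 x = u x

/-- The variation field `∂u_ε(x)/∂ε` at `ε = 0`, a tangent vector at `u(x)`. -/
def Variation.velocity {u : Loop n M} (V : Variation u) (x : ℝ) : TangentSpace (𝓡 n) (u x) :=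
  V.zero x ▸ (mfderiv 𝓘(ℝ, ℝ) (𝓡 n) (fun ε => V.toFun ε x) 0 (1 : ℝ))

/-- A local functional `F[u] = ∫ f(x, u, u_x, u_xx, …) dx`: its density is, in every chart, a smooth
function of `x ∈ S¹` and of finitely many derivatives of the loop. -/
def IsLocalFunctional (F : Loop n M → ℝ) : Prop :=
  ∃ (m : ℕ) (ρ : Loop n M → ℝ → ℝ),
    (∀ u, F u = ∫ x in (0 : ℝ)..1, ρ u x) ∧
    ∀ φ ∈ atlas (Model n) M, ∃ f : ℝ × (Fin (m + 1) → Model n) → ℝ,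
      ContDiffOn ℝ ∞ f {z | z.2 0 ∈ φ.target} ∧
      (∀ x y, f (x + 1, y) = f (x, y)) ∧
      ∀ (u : Loop n M) (x : ℝ), u x ∈ φ.source →
        ρ u x = f (x, fun k => iteratedDeriv (k : ℕ) (fun t => φ (u t)) x)

/-- `α` is the variational derivative `δF/δu` of `F` at the loop `u`:
`d/dε F[u_ε] = ∫ (δF/δuⁱ) (∂uⁱ_ε/∂ε) dx` at `ε = 0`, for every smooth variation of `u`. -/
def IsVariationalDerivAt (F : Loop n M → ℝ) (u : Loop n M) (α : CovectorAlong u) : Prop :=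
  IsSmoothCovector α ∧ ∀ V : Variation u,
    HasDerivAt (fun ε => F (V.toFun ε)) (∫ x in (0 : ℝ)..1, α x (V.velocity x)) 0

open Classical in
/-- The variational derivative `δF/δu` at `u` (zero if there is none). -/
def variationalDeriv (F : Loop n M → ℝ) (u : Loop n M) : CovectorAlong u :=
  if h : ∃ α, IsVariationalDerivAt F u α then h.choose else 0

end LoopSpace

/-! ### Operators of degree two and their brackets -/

/-- The coefficients, in every chart, of an operator
`P^{ij} = a^{ij} (d/dx)² + b^{ij}_k u^k_x d/dx + c^{ij}_{kl} u^k_x u^l_x + d^{ij}_k u^k_xx`. -/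
@[ext]
structure DegreeTwoOperator (n : ℕ) (M : Type*) [TopologicalSpace M]
    [ChartedSpace (Model n) M] where
  a : OpenPartialHomeomorph M (Model n) → Fin n → Fin n → M → ℝ
  b : OpenPartialHomeomorph M (Model n) → Fin n → Fin n → Fin n → M → ℝ
  c : OpenPartialHomeomorph M (Model n) → Fin n → Fin n → Fin n → Fin n → M → ℝ
  d : OpenPartialHomeomorph M (Model n) → Fin n → Fin n → Fin n → M → ℝ

namespace DegreeTwoOperator

variable {n : ℕ} {M : Type*} [TopologicalSpace M] [ChartedSpace (Model n) M]

/-- The linear combination `s P + t Q`. -/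
def linComb (s t : ℝ) (P Q : DegreeTwoOperator n M) : DegreeTwoOperator n M where
  a φ i j p := s * P.a φ i j p + t * Q.a φ i j p
  b φ i j k p := s * P.b φ i j k p + t * Q.b φ i j k p
  c φ i j k l p := s * P.c φ i j k l p + t * Q.c φ i j k l p
  d φ i j k p := s * P.d φ i j k p + t * Q.d φ i j k p

/-- The function `P^{ij}(α_j)` of `x`, computed in the chart `φ`. -/
def apply (P : DegreeTwoOperator n M) (φ : OpenPartialHomeomorph M (Model n)) (u : Loop n M)
    (α : CovectorAlong u) (i : Fin n) (x : ℝ) : ℝ :=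
  let v : Fin n → ℝ → ℝ := fun k t => φ (u t) k
  ∑ j, (P.a φ i j (u x) * iteratedDeriv 2 (comp φ α j) x
    + (∑ k, P.b φ i j k (u x) * deriv (v k) x) * deriv (comp φ α j) x
    + ((∑ k, ∑ l, P.c φ i j k l (u x) * deriv (v k) x * deriv (v l) x)
        + ∑ k, P.d φ i j k (u x) * iteratedDeriv 2 (v k) x) * comp φ α j x)

/-- The function `β_i P^{ij}(α_j)` of `x`, computed in the chart `φ`. -/
def density (P : DegreeTwoOperator n M) (φ : OpenPartialHomeomorph M (Model n)) (u : Loop n M)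
    (β α : CovectorAlong u) (x : ℝ) : ℝ :=
  ∑ i, comp φ β i x * P.apply φ u α i x

/-- The coordinate expressions of `P` define an operator on `L(M)`: the value of `β_i P^{ij}(α_j)`
does not depend on the chart in which it is computed. -/
def IsWellDefined (P : DegreeTwoOperator n M) : Prop :=
  ∀ (u : Loop n M) (β α : CovectorAlong u), IsSmoothCovector β → IsSmoothCovector α →
    ∀ φ ∈ atlas (Model n) M, ∀ ψ ∈ atlas (Model n) M, ∀ x, u x ∈ φ.source → u x ∈ ψ.source →
      P.density φ u β α x = P.density ψ u β α x

/-- The bracket `{F, G}[u] = ∫ (δF/δuⁱ) P^{ij}(δG/δu^j) dx` of functionals on `L(M)`. At each `x`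
the integrand is computed in a chart around `u(x)`. -/
def bracket (P : DegreeTwoOperator n M) (F G : Loop n M → ℝ) (u : Loop n M) : ℝ :=
  ∫ x in (0 : ℝ)..1,
    P.density (chartAt (Model n) (u x)) u (variationalDeriv F u) (variationalDeriv G u) x

/-- `P` is a Hamiltonian operator: it is an operator on `L(M)` whose bracket is skew-symmetric and
satisfies the Jacobi identity on local functionals. -/
structure IsHamiltonian (P : DegreeTwoOperator n M) : Prop where
  wellDefined : P.IsWellDefined
  skew : ∀ F G : Loop n M → ℝ, IsLocalFunctional F → IsLocalFunctional G →
    ∀ u, P.bracket F G u = -P.bracket G F u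
  jacobi : ∀ F G H : Loop n M → ℝ,
    IsLocalFunctional F → IsLocalFunctional G → IsLocalFunctional H → ∀ u,
      P.bracket (P.bracket F G) H u + P.bracket (P.bracket G H) F u
        + P.bracket (P.bracket H F) G u = 0

/-- Two operators are compatible if all their linear combinations are Hamiltonian operators. -/
def Compatible (P Q : DegreeTwoOperator n M) : Prop :=
  ∀ s t : ℝ, (linComb s t P Q).IsHamiltonian

end DegreeTwoOperator

/-- The operator of constant-form type given by a flat Fedosov structure:
`P^{ij} = ω^{ij} (d/dx)² + 2 Γ^{ij}_k u^k_x d/dx + c^{ij}_{kl} u^k_x u^l_x + Γ^{ij}_k u^k_xx`. -/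
def FlatFedosovStructure.operator {n : ℕ} {M : Type*} [TopologicalSpace M]
    [ChartedSpace (Model n) M] [IsManifold (𝓡 n) ∞ M] (S : FlatFedosovStructure n M) :
    DegreeTwoOperator n M where
  a φ i j p := S.upper φ p i j
  b φ i j k p := 2 * S.contraChristoffel φ i j k p
  c φ i j k l p := S.quadCoeff φ i j k l p
  d φ i j k p := S.contraChristoffel φ i j k p

/-! ### Finite-dimensional Poisson and bi-Hamiltonian structures -/

section Finite

variable {n : ℕ} {M : Type*} [TopologicalSpace M] [ChartedSpace (Model n) M]

/-- The operation `{f, g} = w^{ij} (∂f/∂uⁱ) (∂g/∂u^j)` on functions on `M`, computed at each point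
in a chart around that point. -/
def pointBracket (w : OpenPartialHomeomorph M (Model n) → Fin n → Fin n → M → ℝ)
    (f g : M → ℝ) (p : M) : ℝ :=
  let φ := chartAt (Model n) p
  ∑ i, ∑ j, w φ i j p * coordDeriv φ i f p * coordDeriv φ j g p

variable (n) in
/-- `B` is a Poisson bracket on `C^∞(M)`. -/
structure IsPoissonBracket (B : (M → ℝ) → (M → ℝ) → M → ℝ) : Prop where
  smooth : ∀ f g : M → ℝ,
    ContMDiff (𝓡 n) 𝓘(ℝ, ℝ) ∞ f → ContMDiff (𝓡 n) 𝓘(ℝ, ℝ) ∞ g →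
      ContMDiff (𝓡 n) 𝓘(ℝ, ℝ) ∞ (B f g)
  skew : ∀ f g : M → ℝ,
    ContMDiff (𝓡 n) 𝓘(ℝ, ℝ) ∞ f → ContMDiff (𝓡 n) 𝓘(ℝ, ℝ) ∞ g →
      B f g = -B g f
  linear : ∀ (s t : ℝ) (f g h : M → ℝ),
    ContMDiff (𝓡 n) 𝓘(ℝ, ℝ) ∞ f → ContMDiff (𝓡 n) 𝓘(ℝ, ℝ) ∞ g →
      ContMDiff (𝓡 n) 𝓘(ℝ, ℝ) ∞ h →
    B (s • f + t • g) h = s • B f h + t • B g h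
  leibniz : ∀ f g h : M → ℝ,
    ContMDiff (𝓡 n) 𝓘(ℝ, ℝ) ∞ f → ContMDiff (𝓡 n) 𝓘(ℝ, ℝ) ∞ g →
      ContMDiff (𝓡 n) 𝓘(ℝ, ℝ) ∞ h →
    B (f * g) h = f * B g h + g * B f h
  jacobi : ∀ f g h : M → ℝ,
    ContMDiff (𝓡 n) 𝓘(ℝ, ℝ) ∞ f → ContMDiff (𝓡 n) 𝓘(ℝ, ℝ) ∞ g →
      ContMDiff (𝓡 n) 𝓘(ℝ, ℝ) ∞ h →
    B (B f g) h + B (B g h) f + B (B h f) g = 0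

/-- The contravariant tensors `w₁^{ij}` and `w₂^{ij}` form a finite-dimensional bi-Hamiltonian
structure on `M`: all their linear combinations define Poisson brackets on `C^∞(M)`. -/
def IsBiHamiltonian (w₁ w₂ : OpenPartialHomeomorph M (Model n) → Fin n → Fin n → M → ℝ) : Prop :=
  ∀ s t : ℝ, IsPoissonBracket n
    (pointBracket fun φ i j (p : M) => s * w₁ φ i j p + t * w₂ φ i j p)

end Finite

end FedosovPencil

end

/-! The Jacobi identity is tested only on the functionals `∫ θ(x) f(u(x)) dx`, with `θ` a smooth
periodic weight and `f` a smooth function on `M`, and only at constant loops. The variational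
derivative of such a functional is `θ df`, and at a constant loop `u_x` and `u_xx` vanish, so the
operator acts as `a^{ij} D²`.

Let the coefficients of the operator be smooth with `b = 2d`. The bracket of the functionals given
by `(θ, f)` and `(γ, g)` has, at a constant loop, the variational derivative `θγ'' L(f,g) + θ''γ
R(f,g)`, where `L(f,g) = a^{ij} g_j df_i + f_i g_j da^{ij} - d^{ij}_k f_i g_j du^k` and `R(f,g) =
f_i a^{ij} dg_j + d^{ij}_k f_i g_j du^k` (`isVariationalDerivAt_bracket`). The coefficient `c` does
not enter, being multiplied by a quadratic expression in `u_x`; the relation `b = 2d` is what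
cancels the terms in `θ'γ'`. Moreover `L(f,g) + R(f,g)` is the differential of `{f,g} = a^{ij} f_i
g_j` (`mvfderiv_pointBracket`).

Write `L(f,g;h)` and `R(f,g;h)` for the contractions with `a^{ij} h_j`. Give `f, g, h` the weights
`1, cos 2πx, cos 2πx`. In the Jacobi sum the term with outer weight `1` vanishes and the other two
carry the same nonzero factor, so `L(f,g;h) + R(h,f;g) = 0` (`contraction_add_contraction_eq_zero`).
Summing over cyclic permutations regroups this into the sum of the `(L + R)(f,g;h) = {{f,g},h}`,
which is the Jacobi identity on `M`.

This applies to every combination `s P₁ + t P₂`: compatibility makes it Hamiltonian, and smooth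
coefficients, `b = 2d` and skewness of `a` pass to it from the two Fedosov operators. Chart
independence of the operator at constant loops makes the bracket of functions on `M` chart
independent, hence smooth. Since `variationalDeriv` is an arbitrary choice, uniqueness of
variational derivatives (`IsVariationalDerivAt.unique`) is needed before anything can be computed.
-/

noncomputable section

namespace FedosovPencil

/-! ### Differential calculus in a chart of the atlas. -/

section ChartCalculus

variable {n : ℕ} {M : Type*} [TopologicalSpace M] [ChartedSpace (Model n) M]
  [IsManifold (𝓡 n) ∞ M] {φ : OpenPartialHomeomorph M (Model n)}

theorem mdifferentiableAt_chart (hφ : φ ∈ atlas (Model n) M) {p : M} (hp : p ∈ φ.source) :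
    MDifferentiableAt (𝓡 n) (𝓡 n) φ p :=
  mdifferentiableAt_atlas (I := 𝓡 n) hφ hp

theorem contMDiffOn_chart_of_mem (hφ : φ ∈ atlas (Model n) M) :
    ContMDiffOn (𝓡 n) (𝓡 n) ∞ φ φ.source :=
  contMDiffOn_of_mem_maximalAtlas (IsManifold.subset_maximalAtlas hφ)

theorem contMDiffOn_chart_symm_of_mem (hφ : φ ∈ atlas (Model n) M) :
    ContMDiffOn (𝓡 n) (𝓡 n) ∞ φ.symm φ.target :=
  contMDiffOn_symm_of_mem_maximalAtlas (IsManifold.subset_maximalAtlas hφ)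

theorem isInvertible_mvfderiv_chart (hφ : φ ∈ atlas (Model n) M) {p : M} (hp : p ∈ φ.source) :
    (mvfderiv (𝓡 n) φ p).IsInvertible :=
  ⟨(mdifferentiable_of_mem_atlas (I := 𝓡 n) hφ).mfderiv hp, rfl⟩

theorem mvfderiv_chart_coordVF (hφ : φ ∈ atlas (Model n) M) {p : M} (hp : p ∈ φ.source)
    (i : Fin n) : mvfderiv (𝓡 n) φ p (coordVF φ i p) = EuclideanSpace.single i (1 : ℝ) :=
  (isInvertible_mvfderiv_chart hφ hp).self_apply_inverse _

theorem eq_sum_coordVF (hφ : φ ∈ atlas (Model n) M) {p : M} (hp : p ∈ φ.source)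
    (v : TangentSpace (𝓡 n) p) :
    v = ∑ i, (mvfderiv (𝓡 n) φ p v) i • coordVF φ i p := by
  apply (isInvertible_mvfderiv_chart hφ hp).injective
  rw [map_sum]
  simp_rw [map_smul, mvfderiv_chart_coordVF hφ hp]
  ext j
  simp [Pi.single_apply]

/-- A covector is determined by its components. -/
theorem covector_apply_eq_sum (hφ : φ ∈ atlas (Model n) M) {p : M} (hp : p ∈ φ.source)
    (α : TangentSpace (𝓡 n) p →L[ℝ] ℝ) (v : TangentSpace (𝓡 n) p) :
    α v = ∑ i, α (coordVF φ i p) * (mvfderiv (𝓡 n) φ p v) i := by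
  conv_lhs => rw [eq_sum_coordVF hφ hp v]
  simp [mul_comm]

theorem differentiableAt_comp_chart_symm (hφ : φ ∈ atlas (Model n) M) {f : M → ℝ} {p : M}
    (hp : p ∈ φ.source) (hf : MDifferentiableAt (𝓡 n) 𝓘(ℝ, ℝ) f p) :
    DifferentiableAt ℝ (f ∘ φ.symm) (φ p) := by
  rw [← mdifferentiableAt_iff_differentiableAt]
  refine MDifferentiableAt.comp (I' := 𝓡 n) (φ p) ?_
    (mdifferentiableAt_atlas_symm (I := 𝓡 n) hφ (φ.map_source hp))
  rwa [φ.left_inv hp]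

theorem mvfderiv_eq_fderiv_comp (hφ : φ ∈ atlas (Model n) M) {f : M → ℝ} {p : M}
    (hp : p ∈ φ.source) (hf : MDifferentiableAt (𝓡 n) 𝓘(ℝ, ℝ) f p) (v : TangentSpace (𝓡 n) p) :
    mvfderiv (𝓡 n) f p v = fderiv ℝ (f ∘ φ.symm) (φ p) (mvfderiv (𝓡 n) φ p v) := by
  have h1 : f =ᶠ[𝓝 p] (f ∘ φ.symm) ∘ φ := by
    filter_upwards [φ.open_source.mem_nhds hp] with q hq
    simp [φ.left_inv hq]
  have h2 : mfderiv (𝓡 n) 𝓘(ℝ, ℝ) f p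
      = (mfderiv (𝓡 n) 𝓘(ℝ, ℝ) (f ∘ φ.symm) (φ p)).comp (mfderiv (𝓡 n) (𝓡 n) φ p) := by
    rw [h1.mfderiv_eq]
    exact mfderiv_comp p
      (mdifferentiableAt_iff_differentiableAt.2 (differentiableAt_comp_chart_symm hφ hp hf))
      (mdifferentiableAt_chart hφ hp)
  rw [mfderiv_eq_fderiv] at h2
  change mfderiv (𝓡 n) 𝓘(ℝ, ℝ) f p v = _
  rw [h2]
  rfl

theorem coordDeriv_eq_fderiv (hφ : φ ∈ atlas (Model n) M) {f : M → ℝ} {p : M}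
    (hp : p ∈ φ.source) (hf : MDifferentiableAt (𝓡 n) 𝓘(ℝ, ℝ) f p) (i : Fin n) :
    coordDeriv φ i f p = fderiv ℝ (f ∘ φ.symm) (φ p) (EuclideanSpace.single i 1) := by
  rw [coordDeriv, mvfderiv_eq_fderiv_comp hφ hp hf, mvfderiv_chart_coordVF hφ hp]

theorem contDiffOn_comp_chart_symm (hφ : φ ∈ atlas (Model n) M) {f : M → ℝ}
    (hf : ContMDiffOn (𝓡 n) 𝓘(ℝ, ℝ) ∞ f φ.source) : ContDiffOn ℝ ∞ (f ∘ φ.symm) φ.target := by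
  rw [← contMDiffOn_iff_contDiffOn]
  exact hf.comp (contMDiffOn_chart_symm_of_mem hφ) fun y hy => φ.map_target hy

theorem contMDiffOn_of_comp_chart_symm (hφ : φ ∈ atlas (Model n) M) {f : M → ℝ}
    (hf : ContDiffOn ℝ ∞ (f ∘ φ.symm) φ.target) : ContMDiffOn (𝓡 n) 𝓘(ℝ, ℝ) ∞ f φ.source := by
  have h := (contMDiffOn_iff_contDiffOn.2 hf).comp (contMDiffOn_chart_of_mem hφ)
    fun p hp => φ.map_source hp
  exact h.congr fun p hp => by simp [φ.left_inv hp]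

theorem coordDeriv_contMDiffOn (hφ : φ ∈ atlas (Model n) M) {f : M → ℝ}
    (hf : ContMDiffOn (𝓡 n) 𝓘(ℝ, ℝ) ∞ f φ.source) (i : Fin n) :
    ContMDiffOn (𝓡 n) 𝓘(ℝ, ℝ) ∞ (coordDeriv φ i f) φ.source := by
  apply contMDiffOn_of_comp_chart_symm hφ
  have h := ((contDiffOn_comp_chart_symm hφ hf).fderiv_of_isOpen φ.open_target
    (m := ∞) (by simp)).clm_apply (contDiffOn_const (c := EuclideanSpace.single i (1 : ℝ)))
  refine h.congr fun y hy => ?_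
  have hy' := φ.map_target hy
  simp only [Function.comp_apply]
  rw [coordDeriv_eq_fderiv hφ hy' ((hf.contMDiffAt (φ.open_source.mem_nhds hy')).mdifferentiableAt
    (by simp)), φ.right_inv hy]

end ChartCalculus

/-! ### The velocity field of a variation. -/

section Velocity

variable {n : ℕ} {M : Type*} [TopologicalSpace M] [ChartedSpace (Model n) M]

theorem Variation.contMDiff_fst {u : Loop n M} (V : Variation u) (x : ℝ) :
    ContMDiff 𝓘(ℝ, ℝ) (𝓡 n) ∞ (fun ε => V.toFun ε x) := by
  have h : ContMDiff 𝓘(ℝ, ℝ) 𝓘(ℝ, ℝ × ℝ) ∞ (fun ε : ℝ => (ε, x)) :=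
    (contDiff_id.prodMk contDiff_const).contMDiff
  exact V.smooth.comp h

theorem Variation.mvfderiv_velocity {E : Type*} [NormedAddCommGroup E] [NormedSpace ℝ E]
    {u : Loop n M} (V : Variation u) (x : ℝ) {f : M → E}
    (hf : MDifferentiableAt (𝓡 n) 𝓘(ℝ, E) f (u x)) :
    mvfderiv (𝓡 n) f (u x) (V.velocity x) = deriv (fun ε => f (V.toFun ε x)) 0 := by
  -- The base point is generalised to a variable `q`, so that eliminating the equality removes the
  -- transport hidden in `Variation.velocity`.
  have key : ∀ (q : M) (h : V.toFun 0 x = q), MDifferentiableAt (𝓡 n) 𝓘(ℝ, E) f q →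
      mvfderiv (𝓡 n) f q
        (h ▸ (mfderiv 𝓘(ℝ, ℝ) (𝓡 n) (fun ε => V.toFun ε x) 0 (1 : ℝ)))
        = deriv (fun ε => f (V.toFun ε x)) 0 := by
    rintro q rfl hq
    have h2 := mfderiv_comp (I := 𝓘(ℝ, ℝ)) (I' := 𝓡 n) (I'' := 𝓘(ℝ, E)) (0 : ℝ)
      (f := fun ε => V.toFun ε x) (g := f) hq
      ((V.contMDiff_fst x).contMDiffAt.mdifferentiableAt (by simp))
    rw [mfderiv_eq_fderiv] at h2
    rw [← fderiv_apply_one_eq_deriv]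
    change _ = (fderiv ℝ (f ∘ fun ε => V.toFun ε x) 0) 1
    rw [h2]
    rfl
  exact key _ (V.zero x) hf

end Velocity

/-! ### Smooth functions of the variation parameter and of the loop variable. -/

section TwoVariables

variable {h : ℝ × ℝ → ℝ}

theorem deriv_snd_eq_fderiv (hh : ContDiff ℝ ∞ h) (ε x : ℝ) :
    deriv (fun t => h (ε, t)) x = fderiv ℝ h (ε, x) (0, 1) := by
  have h1 : HasDerivAt (fun t : ℝ => (ε, t)) ((0 : ℝ), (1 : ℝ)) x :=
    (hasDerivAt_const x ε).prodMk (hasDerivAt_id x)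
  exact (((hh.differentiable (by simp)) (ε, x)).hasFDerivAt.comp_hasDerivAt x h1).deriv

theorem deriv_fst_eq_fderiv (hh : ContDiff ℝ ∞ h) (ε x : ℝ) :
    deriv (fun s => h (s, x)) ε = fderiv ℝ h (ε, x) (1, 0) := by
  have h1 : HasDerivAt (fun s : ℝ => (s, x)) ((1 : ℝ), (0 : ℝ)) ε :=
    (hasDerivAt_id ε).prodMk (hasDerivAt_const ε x)
  exact (((hh.differentiable (by simp)) (ε, x)).hasFDerivAt.comp_hasDerivAt ε h1).deriv

theorem contDiff_fderiv_apply_const (hh : ContDiff ℝ ∞ h) (v : ℝ × ℝ) :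
    ContDiff ℝ ∞ (fun z => fderiv ℝ h z v) :=
  (hh.fderiv_right (m := ∞) (by simp)).clm_apply contDiff_const

theorem contDiff_deriv_snd (hh : ContDiff ℝ ∞ h) :
    ContDiff ℝ ∞ (fun z : ℝ × ℝ => deriv (fun t => h (z.1, t)) z.2) := by
  simp_rw [deriv_snd_eq_fderiv hh]
  exact contDiff_fderiv_apply_const hh _

theorem contDiff_deriv_fst (hh : ContDiff ℝ ∞ h) :
    ContDiff ℝ ∞ (fun z : ℝ × ℝ => deriv (fun s => h (s, z.2)) z.1) := by
  simp_rw [deriv_fst_eq_fderiv hh]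
  exact contDiff_fderiv_apply_const hh _

theorem contDiff_slice_fst (hh : ContDiff ℝ ∞ h) (x : ℝ) : ContDiff ℝ ∞ (fun s => h (s, x)) :=
  hh.comp (contDiff_id.prodMk contDiff_const)

theorem contDiff_slice_snd (hh : ContDiff ℝ ∞ h) (ε : ℝ) : ContDiff ℝ ∞ (fun t => h (ε, t)) :=
  hh.comp (contDiff_const.prodMk contDiff_id)

theorem hasDerivAt_slice_fst (hh : ContDiff ℝ ∞ h) (ε x : ℝ) :
    HasDerivAt (fun s => h (s, x)) (deriv (fun s => h (s, x)) ε) ε :=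
  ((contDiff_slice_fst hh x).differentiable (by simp) ε).hasDerivAt

/-- Mixed partial derivatives commute. -/
theorem hasDerivAt_deriv_snd (hh : ContDiff ℝ ∞ h) (ε x : ℝ) :
    HasDerivAt (fun s => deriv (fun t => h (s, t)) x)
      (deriv (fun t => deriv (fun s => h (s, t)) ε) x) ε := by
  have e1 : deriv (fun t => deriv (fun s => h (s, t)) ε) x
      = deriv (fun s => deriv (fun t => h (s, t)) x) ε := by
    simp_rw [deriv_snd_eq_fderiv hh, deriv_fst_eq_fderiv hh]
    rw [deriv_snd_eq_fderiv (h := fun z => fderiv ℝ h z (1, 0)) (contDiff_fderiv_apply_const hh _),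
      deriv_fst_eq_fderiv (h := fun z => fderiv ℝ h z (0, 1)) (contDiff_fderiv_apply_const hh _)]
    have hd : DifferentiableAt ℝ (fderiv ℝ h) (ε, x) :=
      (hh.fderiv_right (m := ∞) (by simp)).differentiable (by simp) _
    rw [fderiv_clm_apply hd (differentiableAt_const _),
      fderiv_clm_apply hd (differentiableAt_const _)]
    have hs := (hh.contDiffAt (x := (ε, x))).isSymmSndFDerivAt
      (by simp; exact WithTop.coe_le_coe.2 (le_top : (2 : ℕ∞) ≤ ⊤))
    simpa using hs (0, 1) (1, 0)
  rw [e1]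
  exact hasDerivAt_slice_fst (contDiff_deriv_snd hh) ε x

theorem hasDerivAt_iteratedDeriv_two_snd (hh : ContDiff ℝ ∞ h) (ε x : ℝ) :
    HasDerivAt (fun s => iteratedDeriv 2 (fun t => h (s, t)) x)
      (iteratedDeriv 2 (fun t => deriv (fun s => h (s, t)) ε) x) ε := by
  simp only [iteratedDeriv_succ, iteratedDeriv_zero]
  have e2 : (deriv fun t => deriv (fun s => h (s, t)) ε)
      = fun t => deriv (fun s => deriv (fun t => h (s, t)) t) ε := by
    ext t
    exact (hasDerivAt_deriv_snd hh ε t).deriv.symm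
  rw [e2]
  exact hasDerivAt_deriv_snd (contDiff_deriv_snd hh) ε x

theorem contDiff_iteratedDeriv_two_snd (hh : ContDiff ℝ ∞ h) :
    ContDiff ℝ ∞ (fun z : ℝ × ℝ => iteratedDeriv 2 (fun t => h (z.1, t)) z.2) := by
  simp only [iteratedDeriv_succ, iteratedDeriv_zero]
  exact contDiff_deriv_snd (contDiff_deriv_snd hh)

/-- Differentiation under the integral sign. -/
theorem hasDerivAt_integral_of_contDiff (hh : ContDiff ℝ ∞ h) (ε : ℝ) :
    HasDerivAt (fun s => ∫ x in (0 : ℝ)..1, h (s, x))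
      (∫ x in (0 : ℝ)..1, deriv (fun s => h (s, x)) ε) ε := by
  have hc := (contDiff_deriv_fst hh).continuous
  obtain ⟨C, hC⟩ := ((isCompact_closedBall ε 1).prod (isCompact_Icc (a := (0 : ℝ)) (b := 1))
    ).exists_bound_of_continuousOn hc.continuousOn
  refine (intervalIntegral.hasDerivAt_integral_of_dominated_loc_of_deriv_le
    (F := fun s x => h (s, x)) (F' := fun s x => deriv (fun s => h (s, x)) s)
    (bound := fun _ => C) (s := Metric.closedBall ε 1) (Metric.closedBall_mem_nhds ε one_pos)
    ?_ ?_ ?_ ?_ ?_ ?_).2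
  · exact .of_forall fun s => (contDiff_slice_snd hh s).continuous.aestronglyMeasurable
  · exact (contDiff_slice_snd hh ε).continuous.intervalIntegrable _ _
  · exact (contDiff_slice_snd (contDiff_deriv_fst hh) ε).continuous.aestronglyMeasurable
  · refine .of_forall fun x hx s hs => hC (s, x) ⟨hs, ?_⟩
    rw [Set.uIoc_of_le zero_le_one] at hx
    exact ⟨hx.1.le, hx.2⟩
  · exact intervalIntegrable_const
  · exact .of_forall fun x _ s _ => hasDerivAt_slice_fst hh s x

end TwoVariables

/-! ### Integration by parts over a period. -/

section PeriodicIntegrals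

theorem periodic_deriv {f : ℝ → ℝ} (hf : Function.Periodic f 1) :
    Function.Periodic (deriv f) 1 := by
  intro x
  rw [← deriv_comp_add_const]
  exact congrArg (fun g => deriv g x) (funext hf)

theorem contDiff_deriv {f : ℝ → ℝ} (hf : ContDiff ℝ ∞ f) : ContDiff ℝ ∞ (deriv f) :=
  (contDiff_infty_iff_deriv.1 hf).2

theorem integral_deriv_of_periodic {f : ℝ → ℝ} (hf : ContDiff ℝ ∞ f)
    (hp : Function.Periodic f 1) : ∫ x in (0 : ℝ)..1, deriv f x = 0 := by
  rw [intervalIntegral.integral_deriv_eq_sub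
    (fun x _ => hf.differentiable (by simp) x)
    ((contDiff_deriv hf).continuous.intervalIntegrable _ _)]
  simpa using sub_eq_zero.2 (hp 0)

/-- Integration by parts over a period: the second derivative. -/
theorem integral_mul_deriv_deriv_of_periodic {f g : ℝ → ℝ} (hf : ContDiff ℝ ∞ f)
    (hg : ContDiff ℝ ∞ g) (hfp : Function.Periodic f 1) (hgp : Function.Periodic g 1) :
    ∫ x in (0 : ℝ)..1, f x * deriv (deriv g) x = ∫ x in (0 : ℝ)..1, deriv (deriv f) x * g x := by
  have hf1 := contDiff_deriv hf
  have hg1 := contDiff_deriv hg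
  have hf2 := contDiff_deriv hf1
  have hg2 := contDiff_deriv hg1
  -- The derivative of `f g' - f' g` is the difference `f g'' - f'' g` of the two integrands.
  have key := integral_deriv_of_periodic (f := fun x => f x * deriv g x - deriv f x * g x)
    ((hf.mul hg1).sub (hf1.mul hg)) fun x => by
      simp only [hfp x, hgp x, periodic_deriv hfp x, periodic_deriv hgp x]
  rw [← sub_eq_zero, ← intervalIntegral.integral_sub
    ((hf.mul hg2).continuous.intervalIntegrable _ _)
    ((hf2.mul hg).continuous.intervalIntegrable _ _), ← key]
  congr 1
  ext x
  have d1 := (hf.differentiable (by simp) x).hasDerivAt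
  have d2 := (hg.differentiable (by simp) x).hasDerivAt
  have d3 := (hf1.differentiable (by simp) x).hasDerivAt
  have d4 := (hg1.differentiable (by simp) x).hasDerivAt
  refine Eq.trans ?_ ((d1.mul d4).sub (d3.mul d2)).deriv.symm
  ring

/-- Since `2 w' g' + w'' g = (w g)'' - w g''`, moving two derivatives onto `f` leaves no term in `f'
g'`. The factor `2` is where the relation `b = 2d` enters. -/
theorem integral_two_mul_deriv_add_of_periodic {f g w : ℝ → ℝ} (hf : ContDiff ℝ ∞ f)
    (hg : ContDiff ℝ ∞ g) (hw : ContDiff ℝ ∞ w) (hfp : Function.Periodic f 1)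
    (hgp : Function.Periodic g 1) (hwp : Function.Periodic w 1) :
    ∫ x in (0 : ℝ)..1, f x * (2 * deriv w x * deriv g x + deriv (deriv w) x * g x)
      = ∫ x in (0 : ℝ)..1, (deriv (deriv f) x * g x - f x * deriv (deriv g) x) * w x := by
  have hf1 := contDiff_deriv hf
  have hg1 := contDiff_deriv hg
  have hw1 := contDiff_deriv hw
  have hf2 := contDiff_deriv hf1
  have hg2 := contDiff_deriv hg1
  have hw2 := contDiff_deriv hw1
  -- The primitive is `f (g w)' - f' (g w)`, whose derivative is `f (g w)'' - f'' g w`.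
  have key := integral_deriv_of_periodic
    (f := fun x => f x * deriv g x * w x + f x * g x * deriv w x - deriv f x * g x * w x)
    ((((hf.mul hg1).mul hw).add ((hf.mul hg).mul hw1)).sub ((hf1.mul hg).mul hw)) fun x => by
      simp only [hfp x, hgp x, hwp x, periodic_deriv hfp x, periodic_deriv hgp x,
        periodic_deriv hwp x]
  rw [← sub_eq_zero, ← intervalIntegral.integral_sub, ← key]
  · congr 1
    ext x
    have d1 := (hf.differentiable (by simp) x).hasDerivAt
    have d2 := (hg.differentiable (by simp) x).hasDerivAt
    have d3 := (hw.differentiable (by simp) x).hasDerivAt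
    have e1 := (hf1.differentiable (by simp) x).hasDerivAt
    have e2 := (hg1.differentiable (by simp) x).hasDerivAt
    have e3 := (hw1.differentiable (by simp) x).hasDerivAt
    refine Eq.trans ?_
      ((((d1.mul e2).mul d3).add ((d1.mul d2).mul e3)).sub ((e1.mul d2).mul d3)).deriv.symm
    simp only [Pi.mul_apply]
    ring
  · apply Continuous.intervalIntegrable
    have := hf.continuous; have := hg.continuous; have := hw2.continuous
    have := hw1.continuous; have := hg1.continuous
    fun_prop
  · apply Continuous.intervalIntegrable
    have := hf.continuous; have := hg.continuous; have := hw.continuous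
    have := hf2.continuous; have := hg2.continuous
    fun_prop

end PeriodicIntegrals

/-! ### First variation of a degree two density around data constant in `x`. -/

section DegreeTwoVariation

variable {ι : Type*} [Fintype ι]

/-- One summand `φ P (Q D² + 2 S Y_x D + C Y_x Y_x + S Y_xx) (γ R)` of the density of a degree two
operator, for functions of a variation parameter and of `x`. -/
def degreeTwoIntegrand (φ γ : ℝ → ℝ) (P Q R : ℝ × ℝ → ℝ) (S Y : ι → ℝ × ℝ → ℝ)
    (C : ι → ι → ℝ × ℝ → ℝ) (z : ℝ × ℝ) : ℝ :=
  φ z.2 * P z *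
    (Q z * iteratedDeriv 2 (fun t => γ t * R (z.1, t)) z.2
      + (∑ k, 2 * S k z * deriv (fun t => Y k (z.1, t)) z.2)
        * deriv (fun t => γ t * R (z.1, t)) z.2
      + ((∑ k, ∑ l, C k l z * deriv (fun t => Y k (z.1, t)) z.2
            * deriv (fun t => Y l (z.1, t)) z.2)
          + ∑ k, S k z * iteratedDeriv 2 (fun t => Y k (z.1, t)) z.2)
        * (γ z.2 * R z))

variable {φ γ : ℝ → ℝ} {P Q R : ℝ × ℝ → ℝ} {S Y : ι → ℝ × ℝ → ℝ} {C : ι → ι → ℝ × ℝ → ℝ}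

theorem contDiff_degreeTwoIntegrand (hφ : ContDiff ℝ ∞ φ) (hγ : ContDiff ℝ ∞ γ)
    (hP : ContDiff ℝ ∞ P) (hQ : ContDiff ℝ ∞ Q) (hR : ContDiff ℝ ∞ R)
    (hS : ∀ k, ContDiff ℝ ∞ (S k)) (hY : ∀ k, ContDiff ℝ ∞ (Y k))
    (hC : ∀ k l, ContDiff ℝ ∞ (C k l)) :
    ContDiff ℝ ∞ (degreeTwoIntegrand φ γ P Q R S Y C) := by
  have hγR : ContDiff ℝ ∞ (fun z : ℝ × ℝ => γ z.2 * R z) := (hγ.comp contDiff_snd).mul hR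
  have cY1 := fun k => contDiff_deriv_snd (hY k)
  refine ((hφ.comp contDiff_snd).mul hP).mul
    (((hQ.mul (contDiff_iteratedDeriv_two_snd hγR)).add
      (ContDiff.mul ?_ (contDiff_deriv_snd hγR))).add (ContDiff.mul (ContDiff.add ?_ ?_) hγR))
  · exact ContDiff.sum fun k _ => (contDiff_const.mul (hS k)).mul (cY1 k)
  · exact ContDiff.sum fun k _ => ContDiff.sum fun l _ => ((hC k l).mul (cY1 k)).mul (cY1 l)
  · exact ContDiff.sum fun k _ => (hS k).mul (contDiff_iteratedDeriv_two_snd (hY k))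

/-- First variation at `ε = 0` of the integral of `degreeTwoIntegrand`, when everything but `φ` and
`γ` is constant in `x` there. -/
theorem hasDerivAt_integral_degreeTwoIntegrand (hφ : ContDiff ℝ ∞ φ) (hγ : ContDiff ℝ ∞ γ)
    (hφp : Function.Periodic φ 1) (hγp : Function.Periodic γ 1)
    (hP : ContDiff ℝ ∞ P) (hQ : ContDiff ℝ ∞ Q) (hR : ContDiff ℝ ∞ R)
    (hS : ∀ k, ContDiff ℝ ∞ (S k)) (hY : ∀ k, ContDiff ℝ ∞ (Y k))
    (hC : ∀ k l, ContDiff ℝ ∞ (C k l)) {p q r : ℝ} {s y : ι → ℝ}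
    (hP0 : ∀ x, P (0, x) = p) (hQ0 : ∀ x, Q (0, x) = q) (hR0 : ∀ x, R (0, x) = r)
    (hS0 : ∀ k x, S k (0, x) = s k) (hY0 : ∀ k x, Y k (0, x) = y k)
    (hRp : ∀ ε x, R (ε, x + 1) = R (ε, x)) (hYp : ∀ k ε x, Y k (ε, x + 1) = Y k (ε, x)) :
    IntervalIntegrable (fun x => φ x * deriv (deriv γ) x *
          (deriv (fun ε => P (ε, x)) 0 * q * r + p * deriv (fun ε => Q (ε, x)) 0 * r)
        + deriv (deriv φ) x * γ x * (p * q * deriv (fun ε => R (ε, x)) 0)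
        + ∑ k, s k * p * r * ((deriv (deriv φ) x * γ x - φ x * deriv (deriv γ) x)
            * deriv (fun ε => Y k (ε, x)) 0)) MeasureTheory.volume 0 1 ∧
    HasDerivAt (fun ε => ∫ x in (0 : ℝ)..1, degreeTwoIntegrand φ γ P Q R S Y C (ε, x))
      (∫ x in (0 : ℝ)..1, (φ x * deriv (deriv γ) x *
          (deriv (fun ε => P (ε, x)) 0 * q * r + p * deriv (fun ε => Q (ε, x)) 0 * r)
        + deriv (deriv φ) x * γ x * (p * q * deriv (fun ε => R (ε, x)) 0)
        + ∑ k, s k * p * r * ((deriv (deriv φ) x * γ x - φ x * deriv (deriv γ) x)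
            * deriv (fun ε => Y k (ε, x)) 0))) 0 := by
  have hγR : ContDiff ℝ ∞ (fun z : ℝ × ℝ => γ z.2 * R z) := (hγ.comp contDiff_snd).mul hR
  have main := hasDerivAt_integral_of_contDiff
    (contDiff_degreeTwoIntegrand hφ hγ hP hQ hR hS hY hC) 0
  have hρ : ContDiff ℝ ∞ (fun x => deriv (fun ε => R (ε, x)) 0) :=
    contDiff_slice_snd (contDiff_deriv_fst hR) 0
  have hv : ∀ k, ContDiff ℝ ∞ (fun x => deriv (fun ε => Y k (ε, x)) 0) :=
    fun k => contDiff_slice_snd (contDiff_deriv_fst (hY k)) 0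
  have hP' : ContDiff ℝ ∞ (fun x => deriv (fun ε => P (ε, x)) 0) :=
    contDiff_slice_snd (contDiff_deriv_fst hP) 0
  have hQ' : ContDiff ℝ ∞ (fun x => deriv (fun ε => Q (ε, x)) 0) :=
    contDiff_slice_snd (contDiff_deriv_fst hQ) 0
  have hγ'' := contDiff_deriv (contDiff_deriv hγ)
  have hφ'' := contDiff_deriv (contDiff_deriv hφ)
  -- At `ε = 0` the `x`-derivatives of `Y` vanish, so the quadratic `C` terms contribute nothing and
  -- neither does the variation of `S`; what remains comes from varying `P`, `Q`, `R`, and `Y`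
  -- inside its derivatives.
  have pointwise : ∀ x, deriv (fun ε => degreeTwoIntegrand φ γ P Q R S Y C (ε, x)) 0
      = φ x * deriv (deriv γ) x *
          (deriv (fun ε => P (ε, x)) 0 * q * r + p * deriv (fun ε => Q (ε, x)) 0 * r)
        + p * q * (φ x * deriv (deriv fun t => γ t * deriv (fun ε => R (ε, t)) 0) x)
        + ∑ k, s k * p * r * (φ x * (2 * deriv (fun t => deriv (fun ε => Y k (ε, t)) 0) x
            * deriv γ x + deriv (deriv fun t => deriv (fun ε => Y k (ε, t)) 0) x * γ x)) := by
    intro x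
    have dP := hasDerivAt_slice_fst hP 0 x
    have dQ := hasDerivAt_slice_fst hQ 0 x
    have dS := fun k => hasDerivAt_slice_fst (hS k) 0 x
    have dC := fun k l => hasDerivAt_slice_fst (hC k l) 0 x
    have dY1 := fun k => hasDerivAt_deriv_snd (hY k) 0 x
    have dY2 := fun k => hasDerivAt_iteratedDeriv_two_snd (hY k) 0 x
    have dR0 := hasDerivAt_slice_fst hγR 0 x
    have dR1 := hasDerivAt_deriv_snd hγR 0 x
    have dR2 := hasDerivAt_iteratedDeriv_two_snd hγR 0 x
    have dH := ((dP.const_mul (φ x)).mul (((dQ.mul dR2).add ((HasDerivAt.fun_sum (u := Finset.univ)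
      fun k _ => ((dS k).const_mul 2).mul (dY1 k)).mul dR1)).add
      (((HasDerivAt.fun_sum (u := Finset.univ) fun k _ => HasDerivAt.fun_sum (u := Finset.univ)
        fun l _ => ((dC k l).mul (dY1 k)).mul (dY1 l)).add
      (HasDerivAt.fun_sum (u := Finset.univ) fun k _ => (dS k).mul (dY2 k))).mul dR0))).deriv
    refine Eq.trans dH ?_
    have z1 : ∀ k, deriv (fun t => Y k (0, t)) x = 0 := fun k => by simp [hY0]
    have z2 : ∀ k, iteratedDeriv 2 (fun t => Y k (0, t)) x = 0 := fun k => by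
      simp [hY0, iteratedDeriv_succ]
    have g0 : deriv (fun t => γ t * r) x = deriv γ x * r := by simp
    have g2 : deriv (deriv fun t => γ t * r) x = deriv (deriv γ) x * r := by simp
    have cR : (fun t => deriv (fun s => γ t * R (s, t)) 0)
        = fun t => γ t * deriv (fun ε => R (ε, t)) 0 := by
      ext t
      exact deriv_const_mul_field _
    simp only [Pi.mul_apply, Pi.add_apply, hP0, hQ0, hS0, hR0, z1, z2, cR,
      mul_zero, zero_mul, Finset.sum_const_zero, add_zero,
      zero_add]
    simp only [iteratedDeriv_succ, iteratedDeriv_zero, g0, g2]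
    simp only [Finset.sum_mul, Finset.mul_sum, mul_add, Finset.sum_add_distrib]
    ring_nf
    congr 1
    · congr 1
      exact Finset.sum_congr rfl fun _ _ => by ring
    · exact Finset.sum_congr rfl fun _ _ => by ring
  have i1 : IntervalIntegrable (fun x => φ x * deriv (deriv γ) x *
      (deriv (fun ε => P (ε, x)) 0 * q * r + p * deriv (fun ε => Q (ε, x)) 0 * r))
      MeasureTheory.volume 0 1 := by
    have := hφ.continuous; have := hγ''.continuous; have := hP'.continuous
    have := hQ'.continuous
    exact Continuous.intervalIntegrable (by fun_prop) _ _
  have hRp' : Function.Periodic (fun x => deriv (fun ε => R (ε, x)) 0) 1 := fun x => by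
    simp only [hRp]
  have hYp' : ∀ k, Function.Periodic (fun x => deriv (fun ε => Y k (ε, x)) 0) 1 := fun k x => by
    simp only [hYp]
  have hγρ := hγ.mul hρ
  have cφ := hφ.continuous
  have cγ := hγ.continuous
  have cγ'' := hγ''.continuous
  have cφ'' := hφ''.continuous
  have cρ := hρ.continuous
  have c2 : Continuous fun x => p * q *
      (φ x * deriv (deriv fun t => γ t * deriv (fun ε => R (ε, t)) 0) x) :=
    (cφ.mul (contDiff_deriv (contDiff_deriv hγρ)).continuous).const_mul _
  have j1 : IntervalIntegrable (fun x => deriv (deriv φ) x * γ x *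
      (p * q * deriv (fun ε => R (ε, x)) 0)) MeasureTheory.volume 0 1 :=
    Continuous.intervalIntegrable (by fun_prop) _ _
  have j2 : IntervalIntegrable (fun x => p * q *
      (φ x * deriv (deriv fun t => γ t * deriv (fun ε => R (ε, t)) 0) x))
      MeasureTheory.volume 0 1 := c2.intervalIntegrable _ _
  have c3 : ∀ k, Continuous fun x => φ x * (2 * deriv (fun t => deriv (fun ε => Y k (ε, t)) 0) x
      * deriv γ x + deriv (deriv fun t => deriv (fun ε => Y k (ε, t)) 0) x * γ x) := fun k => by
    have := (contDiff_deriv (hv k)).continuous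
    have := (contDiff_deriv (contDiff_deriv (hv k))).continuous
    have := (contDiff_deriv hγ).continuous
    fun_prop
  have c4 : ∀ k, Continuous fun x => (deriv (deriv φ) x * γ x - φ x * deriv (deriv γ) x)
      * deriv (fun ε => Y k (ε, x)) 0 := fun k => by
    have := (hv k).continuous
    fun_prop
  have j3 := fun k => (c3 k).intervalIntegrable (μ := MeasureTheory.volume) 0 1
  have j4 := fun k => (c4 k).intervalIntegrable (μ := MeasureTheory.volume) 0 1
  have j5 : IntervalIntegrable (fun x => ∑ k, s k * p * r *
      ((deriv (deriv φ) x * γ x - φ x * deriv (deriv γ) x) * deriv (fun ε => Y k (ε, x)) 0))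
      MeasureTheory.volume 0 1 :=
    Continuous.intervalIntegrable (continuous_finsetSum _ fun k _ => (c4 k).const_mul _) _ _
  refine ⟨(i1.add j1).add j5, main.congr_deriv ?_⟩
  simp_rw [pointwise]
  rw [intervalIntegral.integral_add, intervalIntegral.integral_add i1 j2,
    intervalIntegral.integral_add, intervalIntegral.integral_add i1 j1]
  -- The terms varying `P` and `Q` agree already. Two integrations by parts free the variation of
  -- `R`, and `integral_two_mul_deriv_add_of_periodic` frees that of each `Y k`.
  · congr 1
    · congr 1
      rw [intervalIntegral.integral_const_mul,
        integral_mul_deriv_deriv_of_periodic hφ hγρ hφp fun x => by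
          simp only [hγp x, hRp' x],
        ← intervalIntegral.integral_const_mul]
      congr 1
      ext x
      ring
    · rw [intervalIntegral.integral_finsetSum, intervalIntegral.integral_finsetSum]
      · refine Finset.sum_congr rfl fun k _ => ?_
        rw [intervalIntegral.integral_const_mul, intervalIntegral.integral_const_mul,
          integral_two_mul_deriv_add_of_periodic hφ hγ (hv k) hφp hγp (hYp' k)]
      · exact fun k _ => (j4 k).const_mul _
      · exact fun k _ => (j3 k).const_mul _
  · exact i1.add j1
  · exact j5
  · exact i1.add j2
  · exact Continuous.intervalIntegrable (continuous_finsetSum _ fun k _ => (c3 k).const_mul _) _ _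

end DegreeTwoVariation

/-! ### Uniqueness of the variational derivative. -/

section Variational

variable {n : ℕ} {M : Type*} [TopologicalSpace M] [ChartedSpace (Model n) M]
  [IsManifold (𝓡 n) ∞ M] {φ : OpenPartialHomeomorph M (Model n)}

theorem Loop.contDiff_chart (hφ : φ ∈ atlas (Model n) M) {u : Loop n M}
    (hu : ∀ x, u x ∈ φ.source) : ContDiff ℝ ∞ (fun x => φ (u x)) := by
  rw [← contMDiff_iff_contDiff]
  exact (contMDiffOn_chart_of_mem hφ).comp_contMDiff u.smooth hu

omit [IsManifold (𝓡 n) ∞ M] in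
theorem IsSmoothCovector.contDiff_comp {u : Loop n M} {α : CovectorAlong u}
    (hα : IsSmoothCovector α) (hφ : φ ∈ atlas (Model n) M) (hu : ∀ x, u x ∈ φ.source) (i : Fin n) :
    ContDiff ℝ ∞ (comp φ α i) := by
  have h := (hα φ hφ i).1
  rwa [show (u ⁻¹' φ.source : Set ℝ) = Set.univ from Set.eq_univ_of_forall hu,
    contDiffOn_univ] at h

/-- In a chart containing the loop, the pairing of a covector field with a variation field. -/
theorem covector_apply_velocity (hφ : φ ∈ atlas (Model n) M) {u : Loop n M} (α : CovectorAlong u)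
    (V : Variation u) {x : ℝ} (hx : u x ∈ φ.source) :
    α x (V.velocity x) = ∑ i, comp φ α i x * (deriv (fun ε => φ (V.toFun ε x)) 0) i := by
  rw [covector_apply_eq_sum hφ hx, V.mvfderiv_velocity x (mdifferentiableAt_chart hφ hx)]
  rfl

/-- The displacement of a loop lying in one chart by a multiple of a small periodic function. -/
theorem exists_variation_of_displacement (hφ : φ ∈ atlas (Model n) M) {u : Loop n M}
    (hu : ∀ x, u x ∈ φ.source) {w : ℝ → Model n} (hw : ContDiff ℝ ∞ w)
    (hwp : Function.Periodic w 1) :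
    ∃ (V : Variation u) (δ : ℝ), 0 < δ ∧
      ∀ x, deriv (fun ε => φ (V.toFun ε x)) 0 = δ • w x := by
  have hy := Loop.contDiff_chart hφ hu
  have hyp : Function.Periodic (fun x => φ (u x)) 1 := fun x => by simp only [u.periodic x]
  have hK : IsCompact (Set.range fun x => φ (u x)) := by
    rw [← hyp.image_Icc one_pos 0]
    exact isCompact_Icc.image hy.continuous
  have hB : IsCompact (Set.range w) := by
    rw [← hwp.image_Icc one_pos 0]
    exact isCompact_Icc.image hw.continuous
  obtain ⟨B, hB⟩ := hB.isBounded.exists_norm_le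
  have hB0 : 0 ≤ B := (norm_nonneg _).trans (hB _ ⟨0, rfl⟩)
  obtain ⟨r, hr, hrK⟩ := hK.exists_cthickening_subset_open φ.open_target (by
    rintro _ ⟨x, rfl⟩
    exact φ.map_source (hu x))
  -- The bounded factor `sin ε` keeps the displaced loop within distance `r` of the original, hence
  -- in the chart, for every real `ε`. Taking `B + 1` rather than `B` covers the case `w = 0`.
  set δ := r / (B + 1) with hδ
  have hδ0 : 0 < δ := by positivity
  have hmem : ∀ ε x : ℝ, φ (u x) + (δ * Real.sin ε) • w x ∈ φ.target := by
    intro ε x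
    apply hrK
    refine Metric.mem_cthickening_of_dist_le _ (φ (u x)) _ _ (Set.mem_range_self x) ?_
    rw [dist_self_add_left, norm_smul, Real.norm_eq_abs, abs_mul, abs_of_pos hδ0]
    calc δ * |Real.sin ε| * ‖w x‖ ≤ δ * 1 * (B + 1) := by
          gcongr
          · exact Real.abs_sin_le_one ε
          · exact (hB _ ⟨x, rfl⟩).trans (by linarith)
      _ = r := by rw [hδ]; field_simp
  have hsm : ContMDiff 𝓘(ℝ, ℝ × ℝ) (𝓡 n) ∞
      (fun z : ℝ × ℝ => φ.symm (φ (u z.2) + (δ * Real.sin z.1) • w z.2)) := by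
    refine (contMDiffOn_chart_symm_of_mem hφ).comp_contMDiff ?_ fun z => hmem z.1 z.2
    apply ContDiff.contMDiff
    have h1 : ContDiff ℝ ∞ fun z : ℝ × ℝ => φ (u z.2) := hy.comp contDiff_snd
    have h2 : ContDiff ℝ ∞ fun z : ℝ × ℝ => w z.2 := hw.comp contDiff_snd
    have h3 : ContDiff ℝ ∞ fun z : ℝ × ℝ => Real.sin z.1 := Real.contDiff_sin.comp contDiff_fst
    exact h1.add ((contDiff_const.mul h3).smul h2)
  refine ⟨⟨fun ε => ⟨fun x => φ.symm (φ (u x) + (δ * Real.sin ε) • w x), ?_, fun x => ?_⟩,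
    hsm, fun x => ?_⟩, δ, hδ0, fun x => ?_⟩
  · have h : ContMDiff 𝓘(ℝ, ℝ) 𝓘(ℝ, ℝ × ℝ) ∞ (fun x : ℝ => (ε, x)) :=
      (contDiff_const.prodMk contDiff_id).contMDiff
    exact hsm.comp h
  · simp only [u.periodic x, hwp x]
  · simp [φ.left_inv (hu x)]
  · have h : (fun ε => φ (φ.symm (φ (u x) + (δ * Real.sin ε) • w x)))
        = fun ε => φ (u x) + (δ * Real.sin ε) • w x := funext fun ε => φ.right_inv (hmem ε x)
    change deriv (fun ε => φ (φ.symm (φ (u x) + (δ * Real.sin ε) • w x))) 0 = _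
    rw [h]
    have := (((Real.hasDerivAt_sin 0).const_mul δ).smul_const (w x)).const_add (φ (u x))
    simpa using this.deriv

/-- The variational derivative at a loop lying in one chart is unique. -/
theorem IsVariationalDerivAt.unique (hφ : φ ∈ atlas (Model n) M) {F : Loop n M → ℝ} {u : Loop n M}
    (hu : ∀ x, u x ∈ φ.source) {α β : CovectorAlong u} (hα : IsVariationalDerivAt F u α)
    (hβ : IsVariationalDerivAt F u β) : α = β := by
  have ca := hα.1.contDiff_comp hφ hu
  have cb := hβ.1.contDiff_comp hφ hu
  -- The component difference of the two candidates serves as its own test displacement, so that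
  -- equality of the two derivatives says `∫ |w|² = 0`.
  set w : ℝ → Model n := fun x => WithLp.toLp 2 fun i => comp φ α i x - comp φ β i x with hwdef
  have hw : ContDiff ℝ ∞ w := by
    rw [contDiff_euclidean]
    exact fun i => (ca i).sub (cb i)
  have hwp : Function.Periodic w 1 := fun x => by
    simp only [hwdef, (hα.1 φ hφ _).2 x (hu x), (hβ.1 φ hφ _).2 x (hu x)]
  obtain ⟨V, δ, hδ, hV⟩ := exists_variation_of_displacement hφ hu hw hwp
  have e := (hα.2 V).unique (hβ.2 V)
  have expand : ∀ γ : CovectorAlong u, ∀ x, γ x (V.velocity x) = δ * ∑ i, comp φ γ i x * w x i := by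
    intro γ x
    rw [covector_apply_velocity hφ γ V (hu x), hV, Finset.mul_sum]
    refine Finset.sum_congr rfl fun i _ => ?_
    simp only [PiLp.smul_apply, smul_eq_mul]
    ring
  have cw : ∀ i, Continuous fun x => w x i := fun i =>
    ((contDiff_euclidean.1 hw) i).continuous
  simp_rw [expand, intervalIntegral.integral_const_mul] at e
  have e' := mul_left_cancel₀ hδ.ne' e
  have hint : ∀ γ : CovectorAlong u, (∀ i, ContDiff ℝ ∞ (comp φ γ i)) →
      IntervalIntegrable (fun x => ∑ i, comp φ γ i x * w x i) MeasureTheory.volume 0 1 := by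
    intro γ hγ
    exact (continuous_finsetSum _ fun i _ => (hγ i).continuous.mul (cw i)).intervalIntegrable _ _
  rw [← sub_eq_zero, ← intervalIntegral.integral_sub (hint α ca) (hint β cb)] at e'
  have hsq : ∀ x, ∑ i, comp φ α i x * w x i - ∑ i, comp φ β i x * w x i = ∑ i, w x i ^ 2 := by
    intro x
    rw [← Finset.sum_sub_distrib]
    refine Finset.sum_congr rfl fun i _ => ?_
    simp only [hwdef]
    ring
  simp_rw [hsq] at e'
  have cs : Continuous fun x => ∑ i, w x i ^ 2 :=
    continuous_finsetSum _ fun i _ => (cw i).pow 2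
  have hz : ∀ x, w x = 0 := by
    have hz' : ∀ x ∈ Set.Icc (0 : ℝ) 1, w x = 0 := by
      intro x hx
      by_contra hne
      have hpos : 0 < ∑ i, w x i ^ 2 := by
        refine (Finset.sum_nonneg fun i _ => sq_nonneg _).lt_of_ne fun h0 => hne ?_
        ext i
        have := (Finset.sum_eq_zero_iff_of_nonneg fun i _ => sq_nonneg (w x i)).1 h0.symm i
          (Finset.mem_univ i)
        simpa using this
      exact (intervalIntegral.integral_pos one_pos cs.continuousOn
        (fun y _ => Finset.sum_nonneg fun i _ => sq_nonneg _) ⟨x, hx, hpos⟩).ne' e'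
    intro x
    have : w x ∈ w '' Set.Icc 0 (0 + 1) := by
      rw [hwp.image_Icc one_pos 0]
      exact ⟨x, rfl⟩
    obtain ⟨y, hy, hyx⟩ := this
    rw [← hyx]
    exact hz' y (by simpa using hy)
  funext x
  ext v
  rw [covector_apply_eq_sum hφ (hu x), covector_apply_eq_sum hφ (hu x) (β x)]
  refine Finset.sum_congr rfl fun i _ => ?_
  have h := congrArg (fun v : Model n => v i) (hz x)
  simp only [hwdef, PiLp.zero_apply] at h
  have h' : α x (coordVF φ i (u x)) = β x (coordVF φ i (u x)) := sub_eq_zero.1 h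
  rw [h']

theorem IsVariationalDerivAt.variationalDeriv_eq (hφ : φ ∈ atlas (Model n) M)
    {F : Loop n M → ℝ} {u : Loop n M} (hu : ∀ x, u x ∈ φ.source) {α : CovectorAlong u}
    (hα : IsVariationalDerivAt F u α) : variationalDeriv F u = α := by
  have h : ∃ α, IsVariationalDerivAt F u α := ⟨α, hα⟩
  rw [variationalDeriv, dif_pos h]
  exact IsVariationalDerivAt.unique hφ hu h.choose_spec hα

end Variational

/-! ### The test functionals and their variational derivatives. -/

section WeightedFunctional

variable {n : ℕ} {M : Type*} [TopologicalSpace M] [ChartedSpace (Model n) M]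

/-- The functional `∫ θ(x) f(u(x)) dx`. -/
def weightedFunctional (θ : ℝ → ℝ) (f : M → ℝ) (u : Loop n M) : ℝ :=
  ∫ x in (0 : ℝ)..1, θ x * f (u x)

/-- The covector field `θ(x) df` along a loop. -/
def weightedDifferential (θ : ℝ → ℝ) (f : M → ℝ) (u : Loop n M) : CovectorAlong u :=
  fun x => θ x • mvfderiv (𝓡 n) f (u x)

theorem comp_weightedDifferential (θ : ℝ → ℝ) (f : M → ℝ) (u : Loop n M)
    (φ : OpenPartialHomeomorph M (Model n)) (i : Fin n) (x : ℝ) :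
    comp φ (weightedDifferential θ f u) i x = θ x * coordDeriv φ i f (u x) := rfl

variable [IsManifold (𝓡 n) ∞ M] {θ : ℝ → ℝ} {f : M → ℝ}

theorem isSmoothCovector_weightedDifferential (hθ : ContDiff ℝ ∞ θ) (hθp : Function.Periodic θ 1)
    (hf : ContMDiff (𝓡 n) 𝓘(ℝ, ℝ) ∞ f) (u : Loop n M) :
    IsSmoothCovector (weightedDifferential θ f u) := by
  intro φ hφ i
  simp only [funext (comp_weightedDifferential θ f u φ i), u.periodic, hθp _, implies_true,
    and_true]
  refine hθ.contDiffOn.mul ?_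
  rw [← contMDiffOn_iff_contDiffOn]
  exact (coordDeriv_contMDiffOn hφ hf.contMDiffOn i).comp u.smooth.contMDiffOn
    (Set.Subset.refl _)

/-- The density contains no derivative of the loop, so differentiation under the integral gives the
result with no integration by parts, at any loop. -/
theorem isVariationalDerivAt_weightedFunctional (hθ : ContDiff ℝ ∞ θ)
    (hθp : Function.Periodic θ 1) (hf : ContMDiff (𝓡 n) 𝓘(ℝ, ℝ) ∞ f) (u : Loop n M) :
    IsVariationalDerivAt (weightedFunctional θ f) u (weightedDifferential θ f u) := by
  refine ⟨isSmoothCovector_weightedDifferential hθ hθp hf u, fun V => ?_⟩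
  have hfV : ContDiff ℝ ∞ (fun z : ℝ × ℝ => f (V.toFun z.1 z.2)) :=
    contMDiff_iff_contDiff.1 (hf.comp V.smooth)
  have h := hasDerivAt_integral_of_contDiff ((hθ.comp contDiff_snd).mul hfV) 0
  refine h.congr_deriv ?_
  congr 1
  ext x
  refine (deriv_const_mul_field (θ x)).trans ?_
  rw [← V.mvfderiv_velocity x (hf.contMDiffAt.mdifferentiableAt (by simp))]
  rfl

theorem isLocalFunctional_weightedFunctional (hθ : ContDiff ℝ ∞ θ)
    (hθp : Function.Periodic θ 1) (hf : ContMDiff (𝓡 n) 𝓘(ℝ, ℝ) ∞ f) :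
    IsLocalFunctional (weightedFunctional (n := n) θ f) := by
  refine ⟨0, fun u x => θ x * f (u x), fun u => rfl, fun φ hφ =>
    ⟨fun z => θ z.1 * (f ∘ φ.symm) (z.2 0), ?_, fun x y => ?_, fun u x hx => ?_⟩⟩
  · refine (hθ.comp contDiff_fst).contDiffOn.mul
      ((contDiffOn_comp_chart_symm hφ hf.contMDiffOn).comp ?_ fun z hz => hz)
    exact ((contDiff_apply ℝ (Model n) (0 : Fin 1)).comp contDiff_snd).contDiffOn
  · simp only [hθp x]
  · simp [φ.left_inv hx]

end WeightedFunctional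

/-! ### Reduction to variations that stay in a chart. -/

section Reparametrization

/-- A reparametrization of a neighbourhood of `0` by the whole line. -/
theorem exists_reparametrization {δ : ℝ} (hδ : 0 < δ) :
    ∃ σ τ : ℝ → ℝ, ContDiff ℝ ∞ σ ∧ HasDerivAt σ 1 0 ∧ σ 0 = 0 ∧ HasDerivAt τ 1 0 ∧ τ 0 = 0 ∧
      (∀ᶠ ε in 𝓝 0, σ (τ ε) = ε) ∧ ∀ s, |σ s| < δ := by
  -- The maps are `σ s = c arctan (s / c)` and `τ ε = c tan (ε / c)`, scaled to have derivative `1`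
  -- at `0`. The bound `|arctan| < 2` gives `|σ| < 2c = δ`.
  set c := δ / 2 with hc
  have hc0 : 0 < c := by positivity
  refine ⟨fun s => c * Real.arctan (s / c), fun ε => c * Real.tan (ε / c), ?_, ?_, by simp, ?_,
    by simp, ?_, fun s => ?_⟩
  · exact contDiff_const.mul (Real.contDiff_arctan.comp (contDiff_id.div_const c))
  · have h1 : HasDerivAt (fun s : ℝ => s / c) (1 / c) 0 := (hasDerivAt_id 0).div_const c
    have h2 := (h1.arctan).const_mul c
    refine h2.congr_deriv ?_
    simp [hc0.ne']
  · have h1 : HasDerivAt (fun s : ℝ => s / c) (1 / c) 0 := (hasDerivAt_id 0).div_const c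
    have h2 : HasDerivAt Real.tan (1 / Real.cos (0 / c) ^ 2) (0 / c) :=
      Real.hasDerivAt_tan (by simp)
    refine ((h2.comp 0 h1).const_mul c).congr_deriv ?_
    simp [hc0.ne']
  · have hlt : 0 < c * (Real.pi / 2) := by positivity
    filter_upwards [Metric.ball_mem_nhds (0 : ℝ) hlt] with ε hε
    rw [mem_ball_zero_iff, Real.norm_eq_abs, abs_lt] at hε
    have e1 : -(Real.pi / 2) < ε / c := by rw [lt_div_iff₀ hc0]; linarith
    have e2 : ε / c < Real.pi / 2 := by rw [div_lt_iff₀ hc0]; linarith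
    rw [mul_div_cancel_left₀ _ hc0.ne', Real.arctan_tan e1 e2, mul_div_cancel₀ _ hc0.ne']
  · have h1 := Real.neg_pi_div_two_lt_arctan (s / c)
    have h2 := Real.arctan_lt_pi_div_two (s / c)
    have h3 := Real.pi_lt_four
    rw [abs_mul, abs_of_pos hc0]
    have h4 : |Real.arctan (s / c)| < 2 := abs_lt.2 ⟨by linarith, by linarith⟩
    calc c * |Real.arctan (s / c)| < c * 2 := by gcongr
      _ = δ := by rw [hc]; ring

variable {n : ℕ} {M : Type*} [TopologicalSpace M] [ChartedSpace (Model n) M]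

/-- A variation of a loop in an open set stays in that set for small values of the parameter. -/
theorem Variation.exists_forall_mem {u : Loop n M} (V : Variation u) {W : Set M} (hW : IsOpen W)
    (hu : ∀ x, u x ∈ W) : ∃ δ > 0, ∀ ε, |ε| < δ → ∀ x, V.toFun ε x ∈ W := by
  have hopen : IsOpen ((fun z : ℝ × ℝ => V.toFun z.1 z.2) ⁻¹' W) :=
    hW.preimage V.smooth.continuous
  obtain ⟨A, B, hA, -, hA0, hB, hAB⟩ := generalized_tube_lemma (s := {(0 : ℝ)})
    isCompact_singleton (t := Set.Icc (0 : ℝ) (0 + 1)) isCompact_Icc hopen (by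
      rintro ⟨e, x⟩ ⟨he, -⟩
      rw [Set.mem_singleton_iff] at he
      subst he
      change V.toFun 0 x ∈ W
      rw [V.zero x]
      exact hu x)
  obtain ⟨δ, hδ, hball⟩ := Metric.isOpen_iff.1 hA 0 (hA0 rfl)
  refine ⟨δ, hδ, fun ε hε x => ?_⟩
  have hper : Function.Periodic (V.toFun ε) 1 := (V.toFun ε).periodic
  have : V.toFun ε x ∈ V.toFun ε '' Set.Icc 0 (0 + 1) := by
    rw [hper.image_Icc one_pos 0]
    exact ⟨x, rfl⟩
  obtain ⟨y, hy, hyx⟩ := this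
  rw [← hyx]
  exact hAB (Set.mk_mem_prod (hball (by simpa using hε)) (hB hy))

variable [IsManifold (𝓡 n) ∞ M] {φ : OpenPartialHomeomorph M (Model n)}

/-- To differentiate a functional along variations of a loop in a chart it suffices to consider
variations that stay in the chart. -/
theorem hasDerivAt_of_variation_mem (hφ : φ ∈ atlas (Model n) M) {u : Loop n M}
    (hu : ∀ x, u x ∈ φ.source) {F : Loop n M → ℝ} {α : CovectorAlong u}
    (h : ∀ V : Variation u, (∀ ε x, V.toFun ε x ∈ φ.source) →
      HasDerivAt (fun ε => F (V.toFun ε)) (∫ x in (0 : ℝ)..1, α x (V.velocity x)) 0)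
    (V : Variation u) :
    HasDerivAt (fun ε => F (V.toFun ε)) (∫ x in (0 : ℝ)..1, α x (V.velocity x)) 0 := by
  obtain ⟨δ, hδ, hmem⟩ := V.exists_forall_mem φ.open_source hu
  obtain ⟨σ, τ, cσ, dσ, σ0, dτ, τ0, hστ, hσ⟩ := exists_reparametrization hδ
  -- Slowing the variation down by `σ` confines it to the chart for all parameters and keeps its
  -- velocity, because `σ'(0) = 1`.
  let V' : Variation u := ⟨fun s => V.toFun (σ s), by
    have : ContMDiff 𝓘(ℝ, ℝ × ℝ) 𝓘(ℝ, ℝ × ℝ) ∞ (fun z : ℝ × ℝ => (σ z.1, z.2)) :=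
      ((cσ.comp contDiff_fst).prodMk contDiff_snd).contMDiff
    exact V.smooth.comp this, fun x => by rw [σ0, V.zero x]⟩
  have hV' := h V' fun ε x => hmem _ (hσ ε) x
  have hvel : ∀ x, α x (V'.velocity x) = α x (V.velocity x) := by
    intro x
    rw [covector_apply_velocity hφ α V' (hu x), covector_apply_velocity hφ α V (hu x)]
    have hd : DifferentiableAt ℝ (fun ε => φ (V.toFun ε x)) (σ 0) := by
      rw [σ0, ← mdifferentiableAt_iff_differentiableAt]
      have hq : V.toFun 0 x ∈ φ.source := by rw [V.zero x]; exact hu x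
      exact MDifferentiableAt.comp (I' := 𝓡 n) 0 (mdifferentiableAt_chart hφ hq)
        ((V.contMDiff_fst x).contMDiffAt.mdifferentiableAt (by simp))
    have e : deriv (fun ε => φ (V'.toFun ε x)) 0 = deriv (fun ε => φ (V.toFun ε x)) 0 := by
      have := (HasDerivAt.scomp (0 : ℝ) hd.hasDerivAt dσ).deriv
      rw [σ0, one_smul] at this
      exact this
    rw [e]
  simp_rw [hvel] at hV'
  -- Composition with `τ` undoes `σ` near `0`, so the derivative along `V'` transfers to `V` with no
  -- regularity assumed of `F`.
  have h2 := HasDerivAt.comp_of_eq 0 hV' dτ τ0.symm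
  rw [mul_one] at h2
  refine h2.congr_of_eventuallyEq ?_
  filter_upwards [hστ] with ε hε
  simp [V', hε]

end Reparametrization

/-! ### The variational derivative of a bracket at a constant loop. -/

section BracketVariation

variable {n : ℕ} {M : Type*} [TopologicalSpace M] [ChartedSpace (Model n) M]

/-- The constant loop. -/
def constLoop (p : M) : Loop n M := ⟨fun _ => p, contMDiff_const, fun _ => rfl⟩

/-- Operators with smooth coefficients whose coefficients satisfy `b = 2 d`. -/
structure DegreeTwoOperator.IsSmoothSpecial (P : DegreeTwoOperator n M) : Prop where
  a : ∀ o i j, ContMDiffOn (𝓡 n) 𝓘(ℝ, ℝ) ∞ (P.a (chartAt (Model n) o) i j)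
    (chartAt (Model n) o).source
  b : ∀ φ i j k p, P.b φ i j k p = 2 * P.d φ i j k p
  c : ∀ o i j k l, ContMDiffOn (𝓡 n) 𝓘(ℝ, ℝ) ∞ (P.c (chartAt (Model n) o) i j k l)
    (chartAt (Model n) o).source
  d : ∀ o i j k, ContMDiffOn (𝓡 n) 𝓘(ℝ, ℝ) ∞ (P.d (chartAt (Model n) o) i j k)
    (chartAt (Model n) o).source

theorem density_weightedDifferential {P : DegreeTwoOperator n M} (hP : P.IsSmoothSpecial)
    (φ : OpenPartialHomeomorph M (Model n)) (θ γ : ℝ → ℝ) (f g : M → ℝ) (W : ℝ → Loop n M)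
    (ε x : ℝ) :
    P.density φ (W ε) (weightedDifferential θ f (W ε)) (weightedDifferential γ g (W ε)) x
      = ∑ i, ∑ j, degreeTwoIntegrand θ γ (fun z => coordDeriv φ i f (W z.1 z.2))
          (fun z => P.a φ i j (W z.1 z.2)) (fun z => coordDeriv φ j g (W z.1 z.2))
          (fun k z => P.d φ i j k (W z.1 z.2)) (fun k z => φ (W z.1 z.2) k)
          (fun k l z => P.c φ i j k l (W z.1 z.2)) (ε, x) := by
  simp only [DegreeTwoOperator.density, DegreeTwoOperator.apply, Finset.mul_sum, hP.b,
    degreeTwoIntegrand]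
  rfl

/-- The differential of the `k`-th coordinate. -/
def chartCovector (φ : OpenPartialHomeomorph M (Model n)) (k : Fin n) (p : M) :
    TangentSpace (𝓡 n) p →L[ℝ] ℝ :=
  (EuclideanSpace.proj k : Model n →L[ℝ] ℝ).comp (mvfderiv (𝓡 n) φ p)

/-- The covector `f_i a^{ij} dg_j + d^{ij}_k f_i g_j du^k`. -/
def rightCovector (P : DegreeTwoOperator n M) (φ : OpenPartialHomeomorph M (Model n))
    (f g : M → ℝ) (p : M) : TangentSpace (𝓡 n) p →L[ℝ] ℝ :=
  ∑ i, ∑ j, ((coordDeriv φ i f p * P.a φ i j p) • mvfderiv (𝓡 n) (coordDeriv φ j g) p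
    + ∑ k, (P.d φ i j k p * coordDeriv φ i f p * coordDeriv φ j g p) • chartCovector φ k p)

/-- The covector `a^{ij} g_j df_i + f_i g_j da^{ij} - d^{ij}_k f_i g_j du^k`. -/
def leftCovector (P : DegreeTwoOperator n M) (φ : OpenPartialHomeomorph M (Model n))
    (f g : M → ℝ) (p : M) : TangentSpace (𝓡 n) p →L[ℝ] ℝ :=
  ∑ i, ∑ j, ((P.a φ i j p * coordDeriv φ j g p) • mvfderiv (𝓡 n) (coordDeriv φ i f) p
    + (coordDeriv φ i f p * coordDeriv φ j g p) • mvfderiv (𝓡 n) (P.a φ i j) p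
    - ∑ k, (P.d φ i j k p * coordDeriv φ i f p * coordDeriv φ j g p) • chartCovector φ k p)

/-- The variational derivative at a constant loop of the bracket of two weighted functionals. -/
def bracketDifferential (P : DegreeTwoOperator n M) (φ : OpenPartialHomeomorph M (Model n))
    (θ γ : ℝ → ℝ) (f g : M → ℝ) (p : M) : CovectorAlong (constLoop (n := n) p) :=
  fun x => (θ x * deriv (deriv γ) x) • leftCovector P φ f g p
    + (deriv (deriv θ) x * γ x) • rightCovector P φ f g p

/-- A regrouping into the shape in which `hasDerivAt_integral_degreeTwoIntegrand` delivers the first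
variation, one summand for each pair `(i, j)`. -/
theorem bracketDifferential_apply (P : DegreeTwoOperator n M)
    (φ : OpenPartialHomeomorph M (Model n)) (θ γ : ℝ → ℝ) (f g : M → ℝ) (p : M) (x : ℝ)
    (v : TangentSpace (𝓡 n) p) :
    bracketDifferential P φ θ γ f g p x v = ∑ i, ∑ j, (θ x * deriv (deriv γ) x *
        (mvfderiv (𝓡 n) (coordDeriv φ i f) p v * P.a φ i j p * coordDeriv φ j g p
          + coordDeriv φ i f p * mvfderiv (𝓡 n) (P.a φ i j) p v * coordDeriv φ j g p)
      + deriv (deriv θ) x * γ x *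
        (coordDeriv φ i f p * P.a φ i j p * mvfderiv (𝓡 n) (coordDeriv φ j g) p v)
      + ∑ k, P.d φ i j k p * coordDeriv φ i f p * coordDeriv φ j g p *
        ((deriv (deriv θ) x * γ x - θ x * deriv (deriv γ) x) * chartCovector φ k p v)) := by
  change (θ x * deriv (deriv γ) x) * leftCovector P φ f g p v
    + (deriv (deriv θ) x * γ x) * rightCovector P φ f g p v = _
  simp only [leftCovector, rightCovector, add_apply, smul_apply, sum_apply, smul_eq_mul,
    sub_apply, Finset.mul_sum]
  rw [← Finset.sum_add_distrib]
  refine Finset.sum_congr rfl fun i _ => ?_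
  rw [← Finset.sum_add_distrib]
  refine Finset.sum_congr rfl fun j _ => ?_
  have e : ∑ k, P.d φ i j k p * coordDeriv φ i f p * coordDeriv φ j g p *
        ((deriv (deriv θ) x * γ x - θ x * deriv (deriv γ) x) * chartCovector φ k p v)
      = (deriv (deriv θ) x * γ x - θ x * deriv (deriv γ) x) *
        ∑ k, P.d φ i j k p * coordDeriv φ i f p * coordDeriv φ j g p * chartCovector φ k p v := by
    rw [Finset.mul_sum]
    exact Finset.sum_congr rfl fun _ _ => by ring
  rw [e]
  ring

variable [IsManifold (𝓡 n) ∞ M] {θ γ : ℝ → ℝ} {f g : M → ℝ}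

/-- The bracket is defined with a chart that changes with `x`; well-definedness of the operator
replaces it by one fixed chart, in which the integrand can be differentiated. -/
theorem bracket_weightedFunctional {P : DegreeTwoOperator n M} (hP : P.IsWellDefined)
    (hθ : ContDiff ℝ ∞ θ) (hθp : Function.Periodic θ 1) (hγ : ContDiff ℝ ∞ γ)
    (hγp : Function.Periodic γ 1) (hf : ContMDiff (𝓡 n) 𝓘(ℝ, ℝ) ∞ f)
    (hg : ContMDiff (𝓡 n) 𝓘(ℝ, ℝ) ∞ g) {φ : OpenPartialHomeomorph M (Model n)}
    (hφ : φ ∈ atlas (Model n) M) {u : Loop n M} (hu : ∀ x, u x ∈ φ.source) :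
    P.bracket (weightedFunctional θ f) (weightedFunctional γ g) u
      = ∫ x in (0 : ℝ)..1,
          P.density φ u (weightedDifferential θ f u) (weightedDifferential γ g u) x := by
  rw [DegreeTwoOperator.bracket,
    (isVariationalDerivAt_weightedFunctional hθ hθp hf u).variationalDeriv_eq hφ hu,
    (isVariationalDerivAt_weightedFunctional hγ hγp hg u).variationalDeriv_eq hφ hu]
  congr 1
  ext x
  exact hP u _ _ (isSmoothCovector_weightedDifferential hθ hθp hf u)
    (isSmoothCovector_weightedDifferential hγ hγp hg u) _ (chart_mem_atlas _ _) φ hφ x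
    (mem_chart_source _ _) (hu x)

/-- For variations staying in the chart, the bracket is a finite sum of integrals of
`degreeTwoIntegrand`; differentiating each and substituting the velocity gives the covector field.
-/
theorem isVariationalDerivAt_bracket {P : DegreeTwoOperator n M} (hP : P.IsWellDefined)
    (hPs : P.IsSmoothSpecial)
    (hθ : ContDiff ℝ ∞ θ) (hθp : Function.Periodic θ 1) (hγ : ContDiff ℝ ∞ γ)
    (hγp : Function.Periodic γ 1) (hf : ContMDiff (𝓡 n) 𝓘(ℝ, ℝ) ∞ f)
    (hg : ContMDiff (𝓡 n) 𝓘(ℝ, ℝ) ∞ g) (p : M) :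
    IsVariationalDerivAt (P.bracket (weightedFunctional θ f) (weightedFunctional γ g))
      (constLoop p) (bracketDifferential P (chartAt (Model n) p) θ γ f g p) := by
  have hθ'' := contDiff_deriv (contDiff_deriv hθ)
  have hγ'' := contDiff_deriv (contDiff_deriv hγ)
  constructor
  · intro ψ hψ i
    have e : comp ψ (bracketDifferential P (chartAt (Model n) p) θ γ f g p) i = fun x =>
        θ x * deriv (deriv γ) x * leftCovector P (chartAt (Model n) p) f g p (coordVF ψ i p)
        + deriv (deriv θ) x * γ x
          * rightCovector P (chartAt (Model n) p) f g p (coordVF ψ i p) := rfl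
    rw [e]
    refine ⟨ContDiff.contDiffOn ?_, fun x _ => ?_⟩
    · exact ((hθ.mul hγ'').mul contDiff_const).add ((hθ''.mul hγ).mul contDiff_const)
    · simp only [hθp x, hγp x, periodic_deriv (periodic_deriv hθp) x,
        periodic_deriv (periodic_deriv hγp) x]
  set φ := chartAt (Model n) p with hφdef
  have hφ : φ ∈ atlas (Model n) M := chart_mem_atlas _ _
  have hp : p ∈ φ.source := mem_chart_source _ _
  refine hasDerivAt_of_variation_mem hφ (fun _ => hp) fun V hV => ?_
  have pull : ∀ {e : M → ℝ}, ContMDiffOn (𝓡 n) 𝓘(ℝ, ℝ) ∞ e φ.source →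
      ContDiff ℝ ∞ (fun z : ℝ × ℝ => e (V.toFun z.1 z.2)) := fun he =>
    contMDiff_iff_contDiff.1 (he.comp_contMDiff V.smooth fun z => hV z.1 z.2)
  have hfi := fun i => coordDeriv_contMDiffOn hφ hf.contMDiffOn i
  have hgi := fun i => coordDeriv_contMDiffOn hφ hg.contMDiffOn i
  have hcoord : ∀ k, ContMDiffOn (𝓡 n) 𝓘(ℝ, ℝ) ∞ (fun q => φ q k) φ.source := fun k =>
    (((EuclideanSpace.proj k : Model n →L[ℝ] ℝ).contDiff.contMDiff).comp_contMDiffOn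
      (contMDiffOn_chart_of_mem hφ))
  have main := fun i j => hasDerivAt_integral_degreeTwoIntegrand hθ hγ hθp hγp
    (pull (hfi i)) (pull (hPs.a p i j)) (pull (hgi j)) (fun k => pull (hPs.d p i j k))
    (fun k => pull (hcoord k)) (fun k l => pull (hPs.c p i j k l))
    (fun x => congrArg (coordDeriv φ i f) (V.zero x))
    (fun x => congrArg (P.a φ i j) (V.zero x))
    (fun x => congrArg (coordDeriv φ j g) (V.zero x))
    (fun k x => congrArg (P.d φ i j k) (V.zero x))
    (fun k x => congrArg (fun q => φ q k) (V.zero x))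
    (fun ε x => congrArg (coordDeriv φ j g) ((V.toFun ε).periodic x))
    (fun k ε x => congrArg (fun q => φ q k) ((V.toFun ε).periodic x))
  have cont := fun i j => (contDiff_degreeTwoIntegrand hθ hγ
    (pull (hfi i)) (pull (hPs.a p i j)) (pull (hgi j)) (fun k => pull (hPs.d p i j k))
    (fun k => pull (hcoord k)) (fun k l => pull (hPs.c p i j k l)))
  have hF : ∀ ε, P.bracket (weightedFunctional θ f) (weightedFunctional γ g) (V.toFun ε)
      = ∑ i, ∑ j, ∫ x in (0 : ℝ)..1, degreeTwoIntegrand θ γ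
          (fun z => coordDeriv φ i f (V.toFun z.1 z.2))
          (fun z => P.a φ i j (V.toFun z.1 z.2)) (fun z => coordDeriv φ j g (V.toFun z.1 z.2))
          (fun k z => P.d φ i j k (V.toFun z.1 z.2)) (fun k z => φ (V.toFun z.1 z.2) k)
          (fun k l z => P.c φ i j k l (V.toFun z.1 z.2)) (ε, x) := by
    intro ε
    rw [bracket_weightedFunctional hP hθ hθp hγ hγp hf hg hφ (hV ε)]
    simp_rw [density_weightedDifferential hPs φ θ γ f g V.toFun ε]
    have hint := fun i j => (contDiff_slice_snd (cont i j) ε).continuous.intervalIntegrable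
      (μ := MeasureTheory.volume) 0 1
    rw [intervalIntegral.integral_finsetSum fun i _ => ?_]
    · exact Finset.sum_congr rfl fun i _ => intervalIntegral.integral_finsetSum fun j _ => hint i j
    · exact (Continuous.intervalIntegrable (continuous_finsetSum _ fun j _ =>
        (contDiff_slice_snd (cont i j) ε).continuous) _ _)
  simp_rw [hF]
  refine (HasDerivAt.fun_sum (u := Finset.univ) fun i _ =>
    HasDerivAt.fun_sum (u := Finset.univ) fun j _ => (main i j).2).congr_deriv ?_
  simp_rw [← intervalIntegral.integral_finsetSum fun j _ => (main _ j).1]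
  rw [← intervalIntegral.integral_finsetSum fun i _ => ?_]
  · congr 1
    ext x
    have vel : ∀ {e : M → ℝ}, ContMDiffOn (𝓡 n) 𝓘(ℝ, ℝ) ∞ e φ.source →
        deriv (fun ε => e (V.toFun ε x)) 0 = mvfderiv (𝓡 n) e p (V.velocity x) := fun {e} he =>
      (V.mvfderiv_velocity x (f := e)
        ((he.contMDiffAt (φ.open_source.mem_nhds hp)).mdifferentiableAt (by simp))).symm
    have velk : ∀ k, deriv (fun ε => φ (V.toFun ε x) k) 0
        = chartCovector φ k p (V.velocity x) := by
      intro k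
      have hd : DifferentiableAt ℝ (fun ε => φ (V.toFun ε x)) 0 := by
        rw [← mdifferentiableAt_iff_differentiableAt]
        exact MDifferentiableAt.comp (I' := 𝓡 n) 0 (mdifferentiableAt_chart hφ (hV 0 x))
          ((V.contMDiff_fst x).contMDiffAt.mdifferentiableAt (by simp))
      have h1 := V.mvfderiv_velocity x (f := φ) (mdifferentiableAt_chart hφ hp)
      have h2 := ((EuclideanSpace.proj k : Model n →L[ℝ] ℝ).hasFDerivAt.comp_hasDerivAt 0
        hd.hasDerivAt).deriv
      rw [← h1] at h2
      exact h2
    simp only [vel (hfi _), vel (hgi _), vel (hPs.a p _ _), velk]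
    exact (bracketDifferential_apply P φ θ γ f g p x (V.velocity x)).symm
  · have h := IntervalIntegrable.sum Finset.univ fun j _ => (main i j).1
    rwa [Finset.sum_fn] at h

end BracketVariation

/-! ### From the Jacobi identity on the loop space to the one on `M`. -/

section Poisson

variable {n : ℕ} {M : Type*} [TopologicalSpace M] [ChartedSpace (Model n) M]

theorem density_constLoop (P : DegreeTwoOperator n M) (φ : OpenPartialHomeomorph M (Model n))
    (p : M) (β α : CovectorAlong (constLoop (n := n) p)) (x : ℝ) :
    P.density φ (constLoop p) β α x
      = ∑ i, ∑ j, comp φ β i x * P.a φ i j p * iteratedDeriv 2 (comp φ α j) x := by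
  have h1 : ∀ k, deriv (fun _ : ℝ => φ p k) x = 0 := fun k => deriv_const _ _
  have h2 : ∀ k, iteratedDeriv 2 (fun _ : ℝ => φ p k) x = 0 := fun k => by
    simp [iteratedDeriv_succ]
  simp [DegreeTwoOperator.density, DegreeTwoOperator.apply, constLoop, h2, Finset.mul_sum,
    mul_assoc]

theorem density_constLoop_weightedDifferential (P : DegreeTwoOperator n M)
    (φ : OpenPartialHomeomorph M (Model n)) (p : M) (β : CovectorAlong (constLoop (n := n) p))
    (χ : ℝ → ℝ) (h : M → ℝ) (x : ℝ) :
    P.density φ (constLoop p) β (weightedDifferential χ h (constLoop p)) x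
      = deriv (deriv χ) x * ∑ i, ∑ j, comp φ β i x * P.a φ i j p * coordDeriv φ j h p := by
  rw [density_constLoop]
  simp_rw [Finset.mul_sum]
  refine Finset.sum_congr rfl fun i _ => Finset.sum_congr rfl fun j _ => ?_
  have e : comp φ (weightedDifferential χ h (constLoop p)) j
      = fun t => χ t * coordDeriv φ j h p := rfl
  have e2 : iteratedDeriv 2 (fun t => χ t * coordDeriv φ j h p) x
      = deriv (deriv χ) x * coordDeriv φ j h p := by
    simp [iteratedDeriv_succ]
  rw [e, e2]
  ring

/-- The wave `cos 2πx`. -/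
def wave (x : ℝ) : ℝ := Real.cos (2 * Real.pi * x)

theorem contDiff_wave : ContDiff ℝ ∞ wave :=
  Real.contDiff_cos.comp (contDiff_const.mul contDiff_id)

theorem periodic_wave : Function.Periodic wave 1 := fun x => by
  rw [wave, mul_add, mul_one, Real.cos_add_two_pi, wave]

theorem deriv_deriv_wave : deriv (deriv wave) = fun x => -(2 * Real.pi) ^ 2 * wave x := by
  have h1 : deriv wave = fun x => -(2 * Real.pi) * Real.sin (2 * Real.pi * x) := by
    ext x
    have := (((hasDerivAt_id x).const_mul (2 * Real.pi)).cos).deriv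
    refine Eq.trans this ?_
    simp
    ring
  rw [h1]
  ext x
  have := ((((hasDerivAt_id x).const_mul (2 * Real.pi)).sin).const_mul (-(2 * Real.pi))).deriv
  refine Eq.trans this ?_
  simp [wave]
  ring

theorem integral_wave_sq_pos : 0 < ∫ x in (0 : ℝ)..1, wave x * wave x :=
  intervalIntegral.integral_pos one_pos (contDiff_wave.continuous.mul
    contDiff_wave.continuous).continuousOn (fun _ _ => mul_self_nonneg _)
    ⟨0, by simp, by simp [wave]⟩

variable [IsManifold (𝓡 n) ∞ M] {f g h : M → ℝ}

/-- The bracket `a^{ij} f_i g_j` may be computed in any distinguished chart. -/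
theorem pointBracket_eq {P : DegreeTwoOperator n M} (hP : P.IsWellDefined)
    (hf : ContMDiff (𝓡 n) 𝓘(ℝ, ℝ) ∞ f) (hg : ContMDiff (𝓡 n) 𝓘(ℝ, ℝ) ∞ g)
    {φ : OpenPartialHomeomorph M (Model n)} (hφ : φ ∈ atlas (Model n) M) {p : M}
    (hp : p ∈ φ.source) :
    pointBracket P.a f g p = ∑ i, ∑ j, P.a φ i j p * coordDeriv φ i f p * coordDeriv φ j g p := by
  -- At a constant loop the density for `df` and `wave · dg` is `wave'' a^{ij} f_i g_j`, and
  -- `wave''` does not vanish at `x = 0`.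
  have h := hP (constLoop p) (weightedDifferential (fun _ => 1) f (constLoop p))
    (weightedDifferential wave g (constLoop p))
    (isSmoothCovector_weightedDifferential contDiff_const (fun _ => rfl) hf _)
    (isSmoothCovector_weightedDifferential contDiff_wave periodic_wave hg _)
    _ (chart_mem_atlas _ p) φ hφ 0 (mem_chart_source _ p) hp
  rw [density_constLoop_weightedDifferential, density_constLoop_weightedDifferential] at h
  have hne : deriv (deriv wave) 0 ≠ 0 := by
    rw [deriv_deriv_wave]
    simp [wave, Real.pi_ne_zero]
  have h' := mul_left_cancel₀ hne h
  have e : ∀ (ψ : OpenPartialHomeomorph M (Model n)) (i : Fin n),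
      comp ψ (weightedDifferential (fun _ => 1) f (constLoop p)) i 0 = coordDeriv ψ i f p :=
    fun ψ i => one_mul _
  simp_rw [e] at h'
  simp only [pointBracket]
  simp_rw [mul_comm (P.a _ _ _ p)]
  exact h'

theorem contMDiff_pointBracket {P : DegreeTwoOperator n M} (hP : P.IsWellDefined)
    (hPs : P.IsSmoothSpecial) (hf : ContMDiff (𝓡 n) 𝓘(ℝ, ℝ) ∞ f)
    (hg : ContMDiff (𝓡 n) 𝓘(ℝ, ℝ) ∞ g) :
    ContMDiff (𝓡 n) 𝓘(ℝ, ℝ) ∞ (pointBracket P.a f g) := by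
  intro o
  have hφ := chart_mem_atlas (Model n) o
  have ho := (chartAt (Model n) o).open_source.mem_nhds (mem_chart_source _ o)
  have : ContMDiffOn (𝓡 n) 𝓘(ℝ, ℝ) ∞ (pointBracket P.a f g) (chartAt (Model n) o).source := by
    refine ContMDiffOn.congr ?_ fun p hp => pointBracket_eq hP hf hg hφ hp
    refine contMDiffOn_finsetSum fun i _ => contMDiffOn_finsetSum fun j _ => ?_
    exact ((hPs.a o i j).mul (coordDeriv_contMDiffOn hφ hf.contMDiffOn i)).mul
      (coordDeriv_contMDiffOn hφ hg.contMDiffOn j)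
  exact this.contMDiffAt ho

/-- This is the product rule: the terms in `d^{ij}_k` have opposite signs in the two covectors and
cancel. -/
theorem mvfderiv_pointBracket {P : DegreeTwoOperator n M} (hP : P.IsWellDefined)
    (hPs : P.IsSmoothSpecial) (hf : ContMDiff (𝓡 n) 𝓘(ℝ, ℝ) ∞ f)
    (hg : ContMDiff (𝓡 n) 𝓘(ℝ, ℝ) ∞ g) (p : M) (v : TangentSpace (𝓡 n) p) :
    mvfderiv (𝓡 n) (pointBracket P.a f g) p v
      = leftCovector P (chartAt (Model n) p) f g p v
        + rightCovector P (chartAt (Model n) p) f g p v := by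
  set φ := chartAt (Model n) p with hφdef
  have hφ : φ ∈ atlas (Model n) M := chart_mem_atlas _ _
  have hp : p ∈ φ.source := mem_chart_source _ _
  have hn := φ.open_source.mem_nhds hp
  have md : ∀ {e : M → ℝ}, ContMDiffOn (𝓡 n) 𝓘(ℝ, ℝ) ∞ e φ.source →
      MDifferentiableAt (𝓡 n) 𝓘(ℝ, ℝ) e p := fun he => (he.contMDiffAt hn).mdifferentiableAt
        (by simp)
  have dm : ∀ {e : M → ℝ}, ContMDiffOn (𝓡 n) 𝓘(ℝ, ℝ) ∞ e φ.source →
      HasFDerivAt (e ∘ φ.symm) (fderiv ℝ (e ∘ φ.symm) (φ p)) (φ p) := fun he =>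
    (differentiableAt_comp_chart_symm hφ hp (md he)).hasFDerivAt
  have hfi := fun i => coordDeriv_contMDiffOn hφ hf.contMDiffOn i
  have hgi := fun i => coordDeriv_contMDiffOn hφ hg.contMDiffOn i
  have ha := hPs.a p
  rw [mvfderiv_eq_fderiv_comp hφ hp
    ((contMDiff_pointBracket hP hPs hf hg).contMDiffAt.mdifferentiableAt (by simp))]
  have ev : pointBracket P.a f g ∘ φ.symm =ᶠ[𝓝 (φ p)] fun y => ∑ i, ∑ j,
      (P.a φ i j ∘ φ.symm) y * (coordDeriv φ i f ∘ φ.symm) y * (coordDeriv φ j g ∘ φ.symm) y := by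
    filter_upwards [φ.open_target.mem_nhds (φ.map_source hp)] with y hy
    exact pointBracket_eq hP hf hg hφ (φ.map_target hy)
  have D := HasFDerivAt.fun_sum (u := Finset.univ) fun i _ => HasFDerivAt.fun_sum
    (u := Finset.univ) fun j _ => ((dm (ha i j)).mul (dm (hfi i))).mul (dm (hgi j))
  rw [ev.fderiv_eq]
  refine (congrArg (fun L : Model n →L[ℝ] ℝ => L (mvfderiv (𝓡 n) φ p v))
    (HasFDerivAt.fderiv D)).trans ?_
  simp only [leftCovector, rightCovector, add_apply, smul_apply, sum_apply, smul_eq_mul,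
    sub_apply]
  rw [← Finset.sum_add_distrib]
  refine Finset.sum_congr rfl fun i _ => ?_
  rw [← Finset.sum_add_distrib]
  refine Finset.sum_congr rfl fun j _ => ?_
  rw [mvfderiv_eq_fderiv_comp hφ hp (md (hfi i)), mvfderiv_eq_fderiv_comp hφ hp (md (hgi j)),
    mvfderiv_eq_fderiv_comp hφ hp (md (ha i j))]
  simp only [Function.comp_apply, Pi.mul_apply, φ.left_inv hp]
  ring

/-- The contraction of a covector with `a^{ij} h_j`. -/
def contraction (P : DegreeTwoOperator n M) (φ : OpenPartialHomeomorph M (Model n)) (p : M)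
    (α : TangentSpace (𝓡 n) p →L[ℝ] ℝ) (h : M → ℝ) : ℝ :=
  ∑ i, ∑ j, α (coordVF φ i p) * P.a φ i j p * coordDeriv φ j h p

/-- The outer bracket at a constant loop sees the inner one only through its variational derivative
there, and the outer operator is reduced to `a^{ij} D²` acting on `χ dh`. -/
theorem bracket_bracket_constLoop {P : DegreeTwoOperator n M} (hP : P.IsWellDefined)
    (hPs : P.IsSmoothSpecial) {θ γ χ : ℝ → ℝ}
    (hθ : ContDiff ℝ ∞ θ) (hθp : Function.Periodic θ 1) (hγ : ContDiff ℝ ∞ γ)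
    (hγp : Function.Periodic γ 1) (hχ : ContDiff ℝ ∞ χ) (hχp : Function.Periodic χ 1)
    (hf : ContMDiff (𝓡 n) 𝓘(ℝ, ℝ) ∞ f) (hg : ContMDiff (𝓡 n) 𝓘(ℝ, ℝ) ∞ g)
    (hh : ContMDiff (𝓡 n) 𝓘(ℝ, ℝ) ∞ h) (p : M) :
    P.bracket (P.bracket (weightedFunctional θ f) (weightedFunctional γ g))
        (weightedFunctional χ h) (constLoop p)
      = ∫ x in (0 : ℝ)..1, deriv (deriv χ) x *
        (θ x * deriv (deriv γ) x * contraction P (chartAt (Model n) p) p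
            (leftCovector P (chartAt (Model n) p) f g p) h
          + deriv (deriv θ) x * γ x * contraction P (chartAt (Model n) p) p
            (rightCovector P (chartAt (Model n) p) f g p) h) := by
  have hφ := chart_mem_atlas (Model n) p
  have hp : ∀ x, constLoop (n := n) p x ∈ (chartAt (Model n) p).source := fun _ =>
    mem_chart_source _ p
  rw [DegreeTwoOperator.bracket,
    (isVariationalDerivAt_bracket hP hPs hθ hθp hγ hγp hf hg p).variationalDeriv_eq hφ hp,
    (isVariationalDerivAt_weightedFunctional hχ hχp hh (constLoop p)).variationalDeriv_eq hφ hp]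
  congr 1
  ext x
  refine (density_constLoop_weightedDifferential P _ p _ χ h x).trans ?_
  congr 1
  simp only [contraction, Finset.mul_sum]
  rw [← Finset.sum_add_distrib]
  refine Finset.sum_congr rfl fun i _ => ?_
  rw [← Finset.sum_add_distrib]
  refine Finset.sum_congr rfl fun j _ => ?_
  have e : comp (chartAt (Model n) p) (bracketDifferential P (chartAt (Model n) p) θ γ f g p) i x
      = θ x * deriv (deriv γ) x * leftCovector P (chartAt (Model n) p) f g p
          (coordVF (chartAt (Model n) p) i p)
        + deriv (deriv θ) x * γ x * rightCovector P (chartAt (Model n) p) f g p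
          (coordVF (chartAt (Model n) p) i p) := rfl
  refine (congrArg (fun t => t * P.a (chartAt (Model n) p) i j p
    * coordDeriv (chartAt (Model n) p) j h p) e).trans ?_
  ring

/-- The Jacobi identity for functionals with weights `1`, `cos 2πx`, `cos 2πx` at a constant
loop. -/
theorem contraction_add_contraction_eq_zero {P : DegreeTwoOperator n M} (hP : P.IsHamiltonian)
    (hPs : P.IsSmoothSpecial) (hf : ContMDiff (𝓡 n) 𝓘(ℝ, ℝ) ∞ f)
    (hg : ContMDiff (𝓡 n) 𝓘(ℝ, ℝ) ∞ g) (hh : ContMDiff (𝓡 n) 𝓘(ℝ, ℝ) ∞ h) (p : M) :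
    contraction P (chartAt (Model n) p) p (leftCovector P (chartAt (Model n) p) f g p) h
      + contraction P (chartAt (Model n) p) p (rightCovector P (chartAt (Model n) p) h f p) g
      = 0 := by
  have c1 : ContDiff ℝ ∞ (fun _ : ℝ => (1 : ℝ)) := contDiff_const
  have p1 : Function.Periodic (fun _ : ℝ => (1 : ℝ)) 1 := fun _ => rfl
  have J := hP.jacobi _ _ _ (isLocalFunctional_weightedFunctional c1 p1 hf)
    (isLocalFunctional_weightedFunctional contDiff_wave periodic_wave hg)
    (isLocalFunctional_weightedFunctional contDiff_wave periodic_wave hh) (constLoop p)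
  rw [bracket_bracket_constLoop hP.wellDefined hPs c1 p1 contDiff_wave periodic_wave
      contDiff_wave periodic_wave hf hg hh,
    bracket_bracket_constLoop hP.wellDefined hPs contDiff_wave periodic_wave contDiff_wave
      periodic_wave c1 p1 hg hh hf,
    bracket_bracket_constLoop hP.wellDefined hPs contDiff_wave periodic_wave c1 p1
      contDiff_wave periodic_wave hh hf hg] at J
  set A := contraction P (chartAt (Model n) p) p (leftCovector P (chartAt (Model n) p) f g p) h
  set B := contraction P (chartAt (Model n) p) p (rightCovector P (chartAt (Model n) p) h f p) g
  -- The constant weight of `f` kills the whole second term (through `χ''`), the right covector in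
  -- the first (through `θ''`) and the left covector in the third (through `γ''`).
  simp only [deriv_deriv_wave, deriv_const', deriv_const, zero_mul, mul_zero, one_mul, add_zero,
    zero_add, mul_one, intervalIntegral.integral_zero] at J
  have e1 : ∀ D : ℝ, ∫ x in (0 : ℝ)..1, -(2 * Real.pi) ^ 2 * wave x *
      (-(2 * Real.pi) ^ 2 * wave x * D)
      = (2 * Real.pi) ^ 4 * D * ∫ x in (0 : ℝ)..1, wave x * wave x := by
    intro D
    rw [← intervalIntegral.integral_const_mul]
    congr 1
    ext x
    ring
  rw [e1, e1, ← add_mul, ← mul_add] at J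
  have hpi : (2 * Real.pi) ^ 4 ≠ 0 := by positivity
  rcases mul_eq_zero.1 J with h0 | h0
  · exact (mul_eq_zero.1 h0).resolve_left hpi
  · exact absurd h0 integral_wave_sq_pos.ne'

theorem pointBracket_pointBracket {P : DegreeTwoOperator n M} (hP : P.IsWellDefined)
    (hPs : P.IsSmoothSpecial) (hf : ContMDiff (𝓡 n) 𝓘(ℝ, ℝ) ∞ f)
    (hg : ContMDiff (𝓡 n) 𝓘(ℝ, ℝ) ∞ g) (p : M) :
    pointBracket P.a (pointBracket P.a f g) h p
      = contraction P (chartAt (Model n) p) p (leftCovector P (chartAt (Model n) p) f g p) h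
        + contraction P (chartAt (Model n) p) p
          (rightCovector P (chartAt (Model n) p) f g p) h := by
  simp only [contraction]
  rw [← Finset.sum_add_distrib, pointBracket]
  refine Finset.sum_congr rfl fun i _ => ?_
  rw [← Finset.sum_add_distrib]
  refine Finset.sum_congr rfl fun j _ => ?_
  rw [coordDeriv, mvfderiv_pointBracket hP hPs hf hg]
  ring

/-- A Hamiltonian operator with smooth coefficients, `b = 2 d` and skew leading coefficient has a
Poisson tensor as its leading coefficient. -/
theorem isPoissonBracket_of_isHamiltonian {P : DegreeTwoOperator n M} (hP : P.IsHamiltonian)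
    (hPs : P.IsSmoothSpecial) (hskew : ∀ φ i j p, P.a φ i j p = -P.a φ j i p) :
    IsPoissonBracket n (pointBracket P.a) where
  smooth f g hf hg := contMDiff_pointBracket hP.wellDefined hPs hf hg
  skew f g _ _ := by
    ext p
    simp only [pointBracket, Pi.neg_apply]
    rw [Finset.sum_comm, ← Finset.sum_neg_distrib]
    refine Finset.sum_congr rfl fun i _ => ?_
    rw [← Finset.sum_neg_distrib]
    refine Finset.sum_congr rfl fun j _ => ?_
    rw [hskew _ j i]
    ring
  linear s t f g h hf hg _ := by
    ext p
    have mf := hf.contMDiffAt.mdifferentiableAt (x := p) (by simp)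
    have mg := hg.contMDiffAt.mdifferentiableAt (x := p) (by simp)
    have hs : ∀ (r : ℝ) {e : M → ℝ}, MDifferentiableAt (𝓡 n) 𝓘(ℝ, ℝ) e p →
        MDifferentiableAt (𝓡 n) 𝓘(ℝ, ℝ) (r • e) p ∧
          mvfderiv (𝓡 n) (r • e) p = r • mvfderiv (𝓡 n) e p := fun r {e} he => by
      have hc : MDifferentiableAt (𝓡 n) 𝓘(ℝ, ℝ) (fun _ : M => r) p := mdifferentiableAt_const
      refine ⟨hc.mul he, ?_⟩
      have := mvfderiv_mul hc he
      rw [mvfderiv_const, smul_zero, add_zero] at this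
      exact this
    have hd : ∀ (φ : OpenPartialHomeomorph M (Model n)) i, coordDeriv φ i (s • f + t • g) p
        = s * coordDeriv φ i f p + t * coordDeriv φ i g p := by
      intro φ i
      rw [coordDeriv, mvfderiv_add (hs s mf).1 (hs t mg).1, (hs s mf).2, (hs t mg).2]
      rfl
    simp only [pointBracket, Pi.add_apply, Pi.smul_apply, smul_eq_mul, hd, Finset.mul_sum]
    rw [← Finset.sum_add_distrib]
    refine Finset.sum_congr rfl fun i _ => ?_
    rw [← Finset.sum_add_distrib]
    refine Finset.sum_congr rfl fun j _ => ?_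
    ring
  leibniz f g h hf hg _ := by
    ext p
    have mf := hf.contMDiffAt.mdifferentiableAt (x := p) (by simp)
    have mg := hg.contMDiffAt.mdifferentiableAt (x := p) (by simp)
    have hd : ∀ (φ : OpenPartialHomeomorph M (Model n)) i, coordDeriv φ i (f * g) p
        = f p * coordDeriv φ i g p + g p * coordDeriv φ i f p := by
      intro φ i
      rw [coordDeriv, mvfderiv_mul mf mg]
      rfl
    simp only [pointBracket, Pi.add_apply, Pi.mul_apply, hd, Finset.mul_sum]
    rw [← Finset.sum_add_distrib]
    refine Finset.sum_congr rfl fun i _ => ?_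
    rw [← Finset.sum_add_distrib]
    refine Finset.sum_congr rfl fun j _ => ?_
    ring
  jacobi f g h hf hg hh := by
    ext p
    simp only [Pi.add_apply, Pi.zero_apply]
    rw [pointBracket_pointBracket hP.wellDefined hPs hf hg,
      pointBracket_pointBracket hP.wellDefined hPs hg hh,
      pointBracket_pointBracket hP.wellDefined hPs hh hf]
    -- Over the three cyclic instances each left contraction meets the right contraction of the same
    -- triple.
    linarith [contraction_add_contraction_eq_zero hP hPs hf hg hh p,
      contraction_add_contraction_eq_zero hP hPs hg hh hf p,
      contraction_add_contraction_eq_zero hP hPs hh hf hg p]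

end Poisson

/-! ### Smoothness of inverse matrices by Cramer's rule. -/

section MatrixInverse

variable {n : ℕ} {M : Type*} [TopologicalSpace M] [ChartedSpace (Model n) M] {s : Set M}

theorem contMDiffOn_det {m : ℕ} {A : M → Matrix (Fin m) (Fin m) ℝ}
    (hA : ∀ i j, ContMDiffOn (𝓡 n) 𝓘(ℝ, ℝ) ∞ (fun p => A p i j) s) :
    ContMDiffOn (𝓡 n) 𝓘(ℝ, ℝ) ∞ (fun p => (A p).det) s := by
  simp only [Matrix.det_apply']
  refine contMDiffOn_finsetSum fun σ _ => contMDiffOn_const.mul ?_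
  exact contMDiffOn_finsetProd fun i _ => hA _ _

theorem contMDiffOn_matrix_inv {m : ℕ} {A : M → Matrix (Fin m) (Fin m) ℝ}
    (hA : ∀ i j, ContMDiffOn (𝓡 n) 𝓘(ℝ, ℝ) ∞ (fun p => A p i j) s)
    (hdet : ∀ p ∈ s, (A p).det ≠ 0) (i j : Fin m) :
    ContMDiffOn (𝓡 n) 𝓘(ℝ, ℝ) ∞ (fun p => (A p)⁻¹ i j) s := by
  simp only [Matrix.inv_def, Ring.inverse_eq_inv', Matrix.smul_apply, smul_eq_mul,
    Matrix.adjugate_apply]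
  refine ContMDiffOn.mul ((contMDiffOn_det hA).inv₀ hdet) (contMDiffOn_det fun k l => ?_)
  by_cases hk : k = j
  · subst hk
    simpa using contMDiffOn_const
  · simpa [Matrix.updateRow_ne hk] using hA k l

end MatrixInverse

/-! ### The inverse of the symplectic matrix: skewness and smoothness. -/

namespace FlatFedosovStructure

variable {n : ℕ} {M : Type*} [TopologicalSpace M] [ChartedSpace (Model n) M]
  [IsManifold (𝓡 n) ∞ M] (S : FlatFedosovStructure n M)

/-- The identities for inverses of transposes and products hold for singular matrices too, with
inverse `0`, so no relation between `p` and the domain of `φ` is needed. -/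
theorem upper_skew (φ : OpenPartialHomeomorph M (Model n)) (p : M) (i j : Fin n) :
    S.upper φ p i j = -S.upper φ p j i := by
  have h : (S.lower φ p).transpose = S.lower φ p * (-1) := by
    ext k l
    simp [lower, S.form_skew p (coordVF φ l p)]
  have h1 : (-1 : Matrix (Fin n) (Fin n) ℝ)⁻¹ = -1 := Matrix.inv_eq_right_inv (by simp)
  have h2 : (S.upper φ p).transpose = -S.upper φ p := by
    rw [upper, Matrix.transpose_nonsing_inv, h, Matrix.mul_inv_rev, h1, neg_one_mul]
  exact congrFun (congrFun h2 j) i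

/-- A vector `v` annihilated by the matrix gives a tangent vector `Σ vⁱ ∂_i` in the radical of `ω`,
which is zero. -/
theorem det_lower_ne_zero {φ : OpenPartialHomeomorph M (Model n)} (hφ : φ ∈ atlas (Model n) M)
    {p : M} (hp : p ∈ φ.source) : (S.lower φ p).det ≠ 0 := by
  intro h0
  obtain ⟨v, hv, hv0⟩ := Matrix.exists_vecMul_eq_zero_iff.2 h0
  apply hv
  have hX : ∑ i, v i • coordVF φ i p = 0 := by
    refine S.form_nondegenerate p _ fun w => ?_
    rw [eq_sum_coordVF hφ hp w, map_sum]
    refine Finset.sum_eq_zero fun j _ => ?_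
    have := congrFun hv0 j
    rw [Matrix.vecMul, dotProduct] at this
    simp only [lower, Matrix.of_apply] at this
    simp [map_sum, sum_apply, this]
  have := congrArg (mvfderiv (𝓡 n) φ p) hX
  rw [map_sum] at this
  simp_rw [map_smul, mvfderiv_chart_coordVF hφ hp, map_zero] at this
  funext k
  have hk := congrArg (fun w : Model n => w k) this
  simpa [Pi.single_apply] using hk

theorem contMDiffOn_lower {φ : OpenPartialHomeomorph M (Model n)} (hφ : φ ∈ atlas (Model n) M)
    (i j : Fin n) : ContMDiffOn (𝓡 n) 𝓘(ℝ, ℝ) ∞ (fun p => S.lower φ p i j) φ.source :=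
  S.form_smooth φ hφ i j

theorem contMDiffOn_upper {φ : OpenPartialHomeomorph M (Model n)} (hφ : φ ∈ atlas (Model n) M)
    (i j : Fin n) : ContMDiffOn (𝓡 n) 𝓘(ℝ, ℝ) ∞ (fun p => S.upper φ p i j) φ.source :=
  contMDiffOn_matrix_inv (S.contMDiffOn_lower hφ) (fun _ hp => S.det_lower_ne_zero hφ hp) i j

end FlatFedosovStructure

/-! ### Smoothness of the Christoffel symbols and of the operator coefficients. -/

section Christoffel

variable {n : ℕ} {M : Type*} [TopologicalSpace M] [ChartedSpace (Model n) M]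
  [IsManifold (𝓡 n) ∞ M]

/-- The tangent bundle trivialises at `o` through the differential of the preferred chart there.
This turns smoothness of sections into smoothness of their components in that chart. -/
theorem trivializationAt_snd_eq_mvfderiv (o : M) {q : M} (hq : q ∈ (chartAt (Model n) o).source)
    (v : TangentSpace (𝓡 n) q) :
    (trivializationAt (Model n) (TangentSpace (𝓡 n)) o ⟨q, v⟩).2
      = mvfderiv (𝓡 n) (chartAt (Model n) o) q v := by
  have h := congrArg (fun L => L v)
    (TangentBundle.continuousLinearMapAt_trivializationAt (I := 𝓡 n) hq)
  have hq' : q ∈ (trivializationAt (Model n) (TangentSpace (𝓡 n)) o).baseSet := hq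
  rw [Bundle.Trivialization.continuousLinearMapAt_apply,
    Bundle.Trivialization.coe_linearMapAt_of_mem _ hq'] at h
  exact h

theorem contMDiffOn_coordVF (o : M) (i : Fin n) :
    ContMDiffOn (𝓡 n) (𝓡 n).tangent ∞
      (fun q => (⟨q, coordVF (chartAt (Model n) o) i q⟩ : TangentBundle (𝓡 n) M))
      (chartAt (Model n) o).source := by
  refine ((trivializationAt (Model n) (TangentSpace (𝓡 n)) o).contMDiffOn_section_iff
    (chartAt (Model n) o).open_source subset_rfl).2 ?_
  refine (contMDiffOn_const (c := EuclideanSpace.single i (1 : ℝ))).congr fun q hq => ?_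
  rw [trivializationAt_snd_eq_mvfderiv o hq, mvfderiv_chart_coordVF (chart_mem_atlas _ o) hq]

/-- Smoothness of the connection is applied to global sections, whereas `∂_j` is smooth only on the
chart domain; a bump function at `q₀` extends it, and locality of the connection shows that nothing
changes near `q₀`. -/
theorem FlatFedosovStructure.contMDiffOn_christoffel [T2Space M] (S : FlatFedosovStructure n M)
    (o : M) (k i j : Fin n) :
    ContMDiffOn (𝓡 n) 𝓘(ℝ, ℝ) ∞ (S.christoffel (chartAt (Model n) o) k i j)
      (chartAt (Model n) o).source := by
  intro q₀ hq₀
  apply ContMDiffAt.contMDiffWithinAt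
  set φ := chartAt (Model n) o with hφdef
  have hopen := φ.open_source
  obtain ⟨ψ, -, hψ⟩ := (SmoothBumpFunction.nhds_basis_tsupport (I := 𝓡 n) q₀).mem_iff.1
    (hopen.mem_nhds hq₀)
  have hσ : ContMDiff (𝓡 n) (𝓡 n).tangent ∞
      (fun q => (⟨q, ((ψ : M → ℝ) • coordVF φ j) q⟩ : TangentBundle (𝓡 n) M)) :=
    ContMDiffOn.smul_section_of_tsupport ψ.contMDiff.contMDiffOn hopen hψ (contMDiffOn_coordVF o j)
  have hconn := S.conn_smooth.contMDiff.contMDiff (σ := (ψ : M → ℝ) • coordVF φ j)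
    (hσ.contMDiffOn)
  have happ := (hconn.contMDiffAt (x := q₀) Filter.univ_mem).clm_bundle_apply
    ((contMDiffOn_coordVF o i).contMDiffAt (hopen.mem_nhds hq₀))
  have hread := ((trivializationAt (Model n) (TangentSpace (𝓡 n)) o).contMDiffAt_section_iff
    hq₀).1 happ
  have hk := (EuclideanSpace.proj k : Model n →L[ℝ] ℝ).contDiff.contMDiff.contMDiffAt.comp q₀ hread
  refine hk.congr_of_eventuallyEq ?_
  -- Comparing the two covariant derivatives at `q` requires the sections to agree on a
  -- neighbourhood of `q`, not only at `q`.
  filter_upwards [hopen.mem_nhds hq₀, ψ.eventuallyEq_one.eventually_nhds] with q hq hq1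
  have e : S.conn (coordVF φ j) q = S.conn ((ψ : M → ℝ) • coordVF φ j) q := by
    refine S.conn.isCovariantDerivativeOnUniv.congr_of_eventuallyEq
      (((contMDiffOn_coordVF o j).contMDiffAt (hopen.mem_nhds hq)).mdifferentiableAt (by simp))
      (hσ.contMDiffAt.mdifferentiableAt (by simp)) Filter.univ_mem ?_
    filter_upwards [hq1] with r hr
    simp [hr]
  rw [FlatFedosovStructure.christoffel, e]
  simp only [Function.comp_apply]
  rw [trivializationAt_snd_eq_mvfderiv o hq]
  rfl

theorem FlatFedosovStructure.contMDiffOn_contraChristoffel [T2Space M]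
    (S : FlatFedosovStructure n M) (o : M) (i j k : Fin n) :
    ContMDiffOn (𝓡 n) 𝓘(ℝ, ℝ) ∞ (S.contraChristoffel (chartAt (Model n) o) i j k)
      (chartAt (Model n) o).source :=
  (contMDiffOn_finsetSum fun r _ => (S.contMDiffOn_upper (chart_mem_atlas _ o) i r).mul
    (S.contMDiffOn_christoffel o j r k)).neg

theorem FlatFedosovStructure.contMDiffOn_quadCoeff [T2Space M]
    (S : FlatFedosovStructure n M) (o : M) (i j k l : Fin n) :
    ContMDiffOn (𝓡 n) 𝓘(ℝ, ℝ) ∞ (S.quadCoeff (chartAt (Model n) o) i j k l)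
      (chartAt (Model n) o).source := by
  have hφ := chart_mem_atlas (Model n) o
  have hG := S.contMDiffOn_contraChristoffel o
  refine (contMDiffOn_const.mul ((coordDeriv_contMDiffOn hφ (hG i j k) l).add
    (coordDeriv_contMDiffOn hφ (hG i j l) k))).sub (contMDiffOn_const.mul
    (contMDiffOn_finsetSum fun p _ => contMDiffOn_finsetSum fun r _ => ?_))
  exact (S.contMDiffOn_lower hφ p r).mul
    (((hG r i k).mul (hG p j l)).add ((hG r i l).mul (hG p j k)))

theorem FlatFedosovStructure.isSmoothSpecial_linComb [T2Space M]
    (S₁ S₂ : FlatFedosovStructure n M) (s t : ℝ) :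
    (DegreeTwoOperator.linComb s t S₁.operator S₂.operator).IsSmoothSpecial where
  a o i j := (contMDiffOn_const.mul (S₁.contMDiffOn_upper (chart_mem_atlas _ o) i j)).add
    (contMDiffOn_const.mul (S₂.contMDiffOn_upper (chart_mem_atlas _ o) i j))
  b φ i j k p := by
    simp only [DegreeTwoOperator.linComb, FlatFedosovStructure.operator]
    ring
  c o i j k l := (contMDiffOn_const.mul (S₁.contMDiffOn_quadCoeff o i j k l)).add
    (contMDiffOn_const.mul (S₂.contMDiffOn_quadCoeff o i j k l))
  d o i j k := (contMDiffOn_const.mul (S₁.contMDiffOn_contraChristoffel o i j k)).add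
    (contMDiffOn_const.mul (S₂.contMDiffOn_contraChristoffel o i j k))

end Christoffel

end FedosovPencil
end

theorem mainTheorem5 {n : ℕ} {M : Type*} [TopologicalSpace M] [T2Space M]
    [ChartedSpace (FedosovPencil.Model n) M] [IsManifold (𝓡 n) ∞ M]
    (S₁ S₂ : FedosovPencil.FlatFedosovStructure n M)
    (hcompat : FedosovPencil.DegreeTwoOperator.Compatible S₁.operator S₂.operator) :
    FedosovPencil.IsBiHamiltonian S₁.operator.a S₂.operator.a := by
  intro s t
  refine FedosovPencil.isPoissonBracket_of_isHamiltonian (hcompat s t)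
    (S₁.isSmoothSpecial_linComb S₂ s t) fun φ i j p => ?_
  simp only [FedosovPencil.DegreeTwoOperator.linComb, FedosovPencil.FlatFedosovStructure.operator]
  rw [S₁.upper_skew φ p i j, S₂.upper_skew φ p i j]
  ring
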